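/- **Setting.** Let $T\ge 1$, let $Y,X,A$ be measurable spaces with $\sigma$-finite reference measures $\mathrm dy,\mathrm dx,\mathrm da$, and fix a parameter $\theta$. For each period $t=1,\dots,T$ let $f_\theta(y_t\mid y_{t-1},x_t,a)$ be a known, jointly measurable conditional density, $\int f_\theta(y_t\mid y_{t-1},x_t,a)\,\mathrm dy_t=1$ (it may vary with $t$). Let measurable sets $\mathcal S_0\subset Y\times X$, $\mathcal S_A\subset A$ and $\mathcal S_2,\dots,\mathcal S_T\subset X$ be given (the known common supports of $(Y_0,X_1)$, of $A$, and of $X_2,\dots,X_T$). Let $\Omega$ be the set of all nuisance parameters $\omega=(g,\pi,\nu)$ consisting of conditional densities $g(x_t\mid y^{t-1},x^{t-1},a)$, $t=2,\dots,T$ (feedback process), $\pi(a\mid y_0,x_1)$ (heterogeneity) and a density $\nu(y_0,x_1)$ (initial condition), each measurable, integrating to one, and positive exactly on its support $\mathcal S_t$, $\mathcal S_A$ (for $(y_0,x_1)\in\mathcal S_0$), $\mathcal S_0$. Otherwise $\omega$ is unrestricted. Here $y^t=(y_0,\dots,y_t)$, $x^t=(x_1,\dots,x_t)$. Under $(\theta,\omega)$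 the variables $(Y^T,X^T,A)$ have joint density $$p_\omega(y^T,x^T,a)=\prod_{t=1}^T f_\theta(y_t\mid y_{t-1},x_t,a)\prod_{t=2}^T g(x_t\mid y^{t-1},x^{t-1},a)\;\pi(a\mid y_0,x_1)\,\nu(y_0,x_1),$$ and the observed data $(Y^T,X^T)$ have likelihood $\ell(\theta,\omega\mid y^T,x^T)=\int p_\omega\,\mathrm da$; $\mathbb E_{\theta,\omega}$ is the corresponding expectation. Let $\phi_\theta(y^T,x^T)$ be a measurable real function. **Moment restrictions.** Consider the $T$ restrictions $$\text{(i)}\quad \int \phi_\theta(y^T,x^T)\prod_{t=1}^T f_\theta(y_t\mid y_{t-1},x_t,a)\,\mathrm dy^{1:T}=0,$$ $$\text{(ii)}\quad \text{for all } s=2,\dots,T:\quad \int \phi_\theta(y^T,x^T)\prod_{t=s}^T f_\theta(y_t\mid y_{t-1},x_t,a)\,\mathrm dy^{s:T}\ \text{ does not depend on } x^{s:T}.$$ The integrals are iterated integrals, over $y_T$ first, each of them absolutely convergent. The restrictions are understood almost everywhere (for the reference measures) on the common support: (i) holds for almost every $(y_0,x^T,a)$ with $(y_0,x_1)\in\mathcal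 S_0$, $a\in\mathcal S_A$, $x_t\in\mathcal S_t$ for $t\geq 2$; and (ii) means that for each $s$ there is a function $m_s(y^{s-1},x^{s-1},a)$ which equals the integral for almost every $(y^{s-1},x^T,a)$ satisfying these conditions and $f_\theta(y_t\mid y_{t-1},x_t,a)>0$ for all $t<s$. Convergence of the integrals is understood in the same sense. **FHR property.** $\phi_\theta$ is feedback and heterogeneity robust (FHR) if $\mathbb E_{\theta,\omega}[\phi_\theta(Y^T,X^T)]=0$ for all $\omega\in\Omega$ such that $\mathbb E_{\theta,\omega}[|\phi_\theta(Y^T,X^T)|]<\infty$. **Theorem (FHR Moment Characterization).** (A) If $\phi_\theta$ satisfies the $T$ restrictions (i)–(ii), then $\phi_\theta$ is FHR. (B) Suppose that for some $\omega^*\in\Omega$: (1) the root likelihood $\omega\mapsto \ell^{1/2}(\theta,\omega\mid y^T,x^T)$ is differentiable in quadratic mean at $\omega^*$; and (2) there is a neighborhood $\mathcal N$ of $\omega^*$, for some topology on $\Omega$ (whichever one), with $\sup_{\omega\in\mathcal N}\mathbb E_{\theta,\omega}[|\phi_\theta(Y^T,X^T)|^2]<\infty$. Then the converse holds: if $\phi_\theta$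 is FHR, then it satisfies the $T$ restrictions (i)–(ii). In (1), a family $(r_\eta)_{\eta\in\mathbb R}$ of root densities is differentiable in quadratic mean at $0$ with score $S$ if $\int\big(\tfrac{r_\eta-r_0}{\eta}-\tfrac12 S r_0\big)^2\to0$ as $\eta\to0$, the integral being with respect to the reference measure. Condition (1) means that there is a continuous linear operator $D$ from $L^2$ of the law of $(Y^T,X^T,A)$ to $L^2$ of the law of $(Y^T,X^T)$, both under $(\theta,\omega^*)$, such that for every path $\eta\mapsto\omega_\eta$ in $\Omega$ with $\omega_0=\omega^*$ along which $p_{\omega_\eta}^{1/2}$ is differentiable in quadratic mean at $0$ with a square-integrable score $s$, $\ell^{1/2}(\theta,\omega_\eta\mid\cdot)$ is differentiable in quadratic mean at $0$ with score $Ds$. -/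

import Mathlib

open MeasureTheory Filter Topology
open scoped NNReal ENNReal

noncomputable section

/-- The observed data `(y^T, x^T)` of one unit, for `T = n + 1` periods: the outcomes
`y_0, y_1, …, y_T` (so `y j` is `y_j`) and the covariates `x_1, …, x_T` (so `x i` is `x_{i+1}`).
The period `t ∈ {1, …, T}` is represented by the index `i : Fin (n + 1)` with `t = i + 1`:
`y i.succ = y_t`, `y i.castSucc = y_{t-1}` and `x i = x_t`. -/
abbrev PanelData (n : ℕ) (Y X : Type*) : Type _ := (Fin (n + 2) → Y) × (Fin (n + 1) → X)

/-- The known part of the panel data model with feedback over `T = n + 1` periods: σ-finite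
reference measures (`dy`, `dx`, `da`), the parametric family of outcome densities
`f θ i y_t y_{t-1} x_t a = f_θ(y_t | y_{t-1}, x_t, a)` of period `t = i + 1`, and the known
common supports of `(Y_0, X_1)`, of `A`, and of `X_2, …, X_T` (`cov i` is that of `X_{i+2}`). -/
structure PanelModel (n : ℕ) (Θ Y X A : Type*)
    [MeasurableSpace Y] [MeasurableSpace X] [MeasurableSpace A] where
  μY : Measure Y
  μX : Measure X
  μA : Measure A
  sigmaFinite_Y : SigmaFinite μY
  sigmaFinite_X : SigmaFinite μX
  sigmaFinite_A : SigmaFinite μA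
  f : Θ → Fin (n + 1) → Y → Y → X → A → ℝ≥0
  measurable_f : ∀ θ i, Measurable fun p : Y × Y × X × A => f θ i p.1 p.2.1 p.2.2.1 p.2.2.2
  lintegral_f : ∀ θ i y x a, ∫⁻ z, (f θ i z y x a : ℝ≥0∞) ∂μY = 1
  init : Set (Y × X)
  het : Set A
  cov : Fin n → Set X
  measurableSet_init : MeasurableSet init
  measurableSet_het : MeasurableSet het
  measurableSet_cov : ∀ i, MeasurableSet (cov i)

namespace PanelModel

variable {n : ℕ} {Θ Y X A : Type*}
  [MeasurableSpace Y] [MeasurableSpace X] [MeasurableSpace A]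

attribute [instance] sigmaFinite_Y sigmaFinite_X sigmaFinite_A

/-- The reference measure on the observed data. -/
def refData (M : PanelModel n Θ Y X A) : Measure (PanelData n Y X) :=
  (Measure.pi fun _ => M.μY).prod (Measure.pi fun _ => M.μX)

/-- The reference measure on the observed data together with the latent heterogeneity. -/
def refFull (M : PanelModel n Θ Y X A) : Measure (PanelData n Y X × A) :=
  M.refData.prod M.μA

/-- The set `Ω` of nuisance parameters `ω = (g, π, ν)`: all feedback processes, heterogeneity
densities and initial condition densities with the given common supports.

For `i : Fin n`, `g i y x a` is the density of `X_t` with `t = i + 2` at `x_t = x i.succ`, given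
`y^{t-1} = (y_0, …, y_{t-1})`, `x^{t-1} = (x_1, …, x_{t-1})` and `a`; it is written as a function
of whole paths that does not look at `y_t, …, y_T` or `x_{t+1}, …, x_T`. -/
structure Nuisance (M : PanelModel n Θ Y X A) where
  g : Fin n → (Fin (n + 2) → Y) → (Fin (n + 1) → X) → A → ℝ≥0
  π : A → Y → X → ℝ≥0
  ν : Y → X → ℝ≥0
  measurable_g : ∀ i, Measurable fun p : (Fin (n + 2) → Y) × (Fin (n + 1) → X) × A =>
    g i p.1 p.2.1 p.2.2
  measurable_π : Measurable fun p : A × Y × X => π p.1 p.2.1 p.2.2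
  measurable_ν : Measurable fun p : Y × X => ν p.1 p.2
  g_past : ∀ i y y' x x' a, (∀ j : Fin (n + 2), j ≤ i.succ.castSucc → y j = y' j) →
    (∀ j : Fin (n + 1), j ≤ i.succ → x j = x' j) → g i y x a = g i y' x' a
  lintegral_g : ∀ i y x a, ∫⁻ z, (g i y (Function.update x i.succ z) a : ℝ≥0∞) ∂M.μX = 1
  lintegral_π : ∀ y x, ∫⁻ a, (π a y x : ℝ≥0∞) ∂M.μA = 1
  lintegral_ν : ∫⁻ p, (ν p.1 p.2 : ℝ≥0∞) ∂(M.μY.prod M.μX) = 1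
  g_pos_iff : ∀ i y x a, 0 < g i y x a ↔ x i.succ ∈ M.cov i
  π_pos_iff : ∀ a y x, (y, x) ∈ M.init → (0 < π a y x ↔ a ∈ M.het)
  ν_pos_iff : ∀ y x, 0 < ν y x ↔ (y, x) ∈ M.init

/-- The joint density of `(Y^T, X^T, A)` at `(θ, ω)`:
`∏_{t=1}^T f_θ(y_t | y_{t-1}, x_t, a) ∏_{t=2}^T g(x_t | y^{t-1}, x^{t-1}, a) π(a | y_0, x_1)
ν(y_0, x_1)`. -/
def jointDensity (M : PanelModel n Θ Y X A) (θ : Θ) (ω : M.Nuisance)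
    (p : PanelData n Y X × A) : ℝ≥0 :=
  (∏ i : Fin (n + 1), M.f θ i (p.1.1 i.succ) (p.1.1 i.castSucc) (p.1.2 i) p.2) *
    (∏ i : Fin n, ω.g i p.1.1 p.1.2 p.2) * ω.π p.2 (p.1.1 0) (p.1.2 0) *
    ω.ν (p.1.1 0) (p.1.2 0)

/-- The likelihood `ℓ(θ, ω | y^T, x^T)` of the observed data (heterogeneity integrated out). -/
def likelihood (M : PanelModel n Θ Y X A) (θ : Θ) (ω : M.Nuisance)
    (z : PanelData n Y X) : ℝ≥0∞ :=
  ∫⁻ a, (M.jointDensity θ ω (z, a) : ℝ≥0∞) ∂M.μA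

/-- The law of `(Y^T, X^T, A)` at `(θ, ω)`. -/
def jointLaw (M : PanelModel n Θ Y X A) (θ : Θ) (ω : M.Nuisance) :
    Measure (PanelData n Y X × A) :=
  M.refFull.withDensity fun p => (M.jointDensity θ ω p : ℝ≥0∞)

/-- The law of the observed data `(Y^T, X^T)` at `(θ, ω)`; `𝔼_{θ,ω}` is integration against it. -/
def dataLaw (M : PanelModel n Θ Y X A) (θ : Θ) (ω : M.Nuisance) : Measure (PanelData n Y X) :=
  M.refData.withDensity (M.likelihood θ ω)

/-- The FHR property: `φ` has mean zero under every `ω` under which it is absolutely integrable. -/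
def IsFHR (M : PanelModel n Θ Y X A) (θ : Θ) (φ : PanelData n Y X → ℝ) : Prop :=
  ∀ ω : M.Nuisance, Integrable φ (M.dataLaw θ ω) → ∫ z, φ z ∂(M.dataLaw θ ω) = 0

/-- `M.partialIntegral θ φ k y x a` is `∫ φ(y^T, x^T) ∏_{t=k+1}^T f_θ(y_t | y_{t-1}, x_t, a)
dy^{k+1:T}`, computed as an iterated integral, over `y_T` first and over `y_{k+1}` last. It does
not involve the coordinates `y_{k+1}, …, y_T` of its argument `y`. -/
def partialIntegral (M : PanelModel n Θ Y X A) (θ : Θ) (φ : PanelData n Y X → ℝ)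
    (k : Fin (n + 2)) : (Fin (n + 2) → Y) → (Fin (n + 1) → X) → A → ℝ :=
  Fin.reverseInduction (motive := fun _ => (Fin (n + 2) → Y) → (Fin (n + 1) → X) → A → ℝ)
    (fun y x _ => φ (y, x))
    (fun i ψ y x a =>
      ∫ z, ψ (Function.update y i.succ z) x a * (M.f θ i z (y i.castSucc) (x i) a : ℝ) ∂M.μY)
    k

/-- `(y_0, …, y_k, x_1, …, x_T, a)` lies in the common support: `(y_0, x_1)`, `x_2, …, x_T` and
`a` lie in theirs, and `f_θ(y_t | y_{t-1}, x_t, a) > 0` for `t = 1, …, k`. -/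
def InSupport (M : PanelModel n Θ Y X A) (θ : Θ) (k : Fin (n + 2))
    (p : PanelData n Y X × A) : Prop :=
  (p.1.1 0, p.1.2 0) ∈ M.init ∧ p.2 ∈ M.het ∧ (∀ i : Fin n, p.1.2 i.succ ∈ M.cov i) ∧
    ∀ i : Fin (n + 1), i.succ ≤ k →
      0 < M.f θ i (p.1.1 i.succ) (p.1.1 i.castSucc) (p.1.2 i) p.2

/-- The `T` moment restrictions, almost everywhere on the common support; the integrals in them
are required to converge absolutely. In `feedback`, the index `i` stands for `s = i + 2`, and the
function `m` of `(y^{s-1}, x^{s-1}, a)` witnesses that the integral does not depend on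
`x^{s:T}`. -/
structure MomentRestrictions (M : PanelModel n Θ Y X A) (θ : Θ) (φ : PanelData n Y X → ℝ) :
    Prop where
  integrable : ∀ i : Fin (n + 1), ∀ᵐ p ∂M.refFull, M.InSupport θ i.castSucc p →
    Integrable (fun z => M.partialIntegral θ φ i.succ (Function.update p.1.1 i.succ z) p.1.2 p.2 *
      (M.f θ i z (p.1.1 i.castSucc) (p.1.2 i) p.2 : ℝ)) M.μY
  hetero : ∀ᵐ p ∂M.refFull, M.InSupport θ 0 p → M.partialIntegral θ φ 0 p.1.1 p.1.2 p.2 = 0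
  feedback : ∀ i : Fin n, ∃ m : (Fin (n + 2) → Y) → (Fin (n + 1) → X) → A → ℝ,
    (∀ y y' x x' a, (∀ j : Fin (n + 2), j ≤ i.succ.castSucc → y j = y' j) →
      (∀ j : Fin (n + 1), j < i.succ → x j = x' j) → m y x a = m y' x' a) ∧
    ∀ᵐ p ∂M.refFull, M.InSupport θ i.succ.castSucc p →
      M.partialIntegral θ φ i.succ.castSucc p.1.1 p.1.2 p.2 = m p.1.1 p.1.2 p.2

end PanelModel

/-- The one-parameter family of root densities `r η`, `η ∈ ℝ`, with respect to `μ` is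
differentiable in quadratic mean at `η = 0` with score `S`:
`∫ ((r η - r 0) / η - S * r 0 / 2)² dμ → 0` as `η → 0`. -/
def HasQuadraticMeanScore {Z : Type*} [MeasurableSpace Z] (μ : Measure Z) (r : ℝ → Z → ℝ)
    (S : Z → ℝ) : Prop :=
  Tendsto (fun η : ℝ => ∫⁻ z, ENNReal.ofReal (((r η z - r 0 z) / η - S z * r 0 z / 2) ^ 2) ∂μ)
    (𝓝[≠] 0) (𝓝 0)

namespace PanelModel

variable {n : ℕ} {Θ Y X A : Type*}
  [MeasurableSpace Y] [MeasurableSpace X] [MeasurableSpace A]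

/-- The root likelihood `ω ↦ ℓ(θ, ω | ·)^{1/2}` is differentiable in quadratic mean at `ωs`: there
is a continuous linear score operator `D` such that, along every smooth path `η ↦ ω_η` in `Ω` with
`ω_0 = ωs` and with square-integrable nuisance score `s(Y^T, X^T, A)`, the path
`η ↦ ℓ(θ, ω_η | ·)^{1/2}` is differentiable in quadratic mean at `0` with score `D s`. -/
def RootLikelihoodDQM (M : PanelModel n Θ Y X A) (θ : Θ) (ωs : M.Nuisance) : Prop :=
  ∃ D : Lp ℝ 2 (M.jointLaw θ ωs) →L[ℝ] Lp ℝ 2 (M.dataLaw θ ωs),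
    ∀ (ω : ℝ → M.Nuisance) (s : Lp ℝ 2 (M.jointLaw θ ωs)), ω 0 = ωs →
      HasQuadraticMeanScore M.refFull (fun η p => √(M.jointDensity θ (ω η) p : ℝ)) s →
      HasQuadraticMeanScore M.refData (fun η z => √(M.likelihood θ (ω η) z).toReal) (D s)

end PanelModel

end

/-! Both directions rest on one backward recursion: the mean of `φ` is integrated over `y_T`, then
`x_T`, then `y_{T-1}`, and so on down to `(y_0, x_1, a)`. Integrating an outcome against its density
`f` turns one partial integral of `φ` into the next one. By (ii), integrating a covariate against
any feedback density leaves the partial integral unchanged, and by (i) what remains at the end is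
zero. This is (A).

For (B), perturb the nuisance parameter. If `h` is a bounded function of the past up to and
including `x_t`, and `E h` is its mean over `x_t`, then `g` times `1 + (h - E h)/4` is again an
admissible feedback density. The mean of `φ` is affine in the tilt, so comparing two mean-zero
identities makes `φ` orthogonal to `h - E h` (`IsFHR.integral_feedback_score_eq_zero`). Along the
recursion the partial integral `χ` is the conditional mean of `φ` given the past, and the choice `h
= sign (χ - E χ)` forces `χ = E χ`, so `χ` does not involve `x_t` (`IsPastVersion.feedback`). At the
bottom, tilting the joint law of `(A, Y_0, X_1)` by the sign of what remains forces it to vanish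
(`IsFHR.integral_initial_eq_zero`).

To stay on one product space, a coordinate that has been integrated out is refilled with a fixed
reference probability density (`IsCoordinate.refill`, `truncDensity`). These densities are chosen so
that the truncated density is positive exactly on the common support, which turns vanishing
integrals into statements almost everywhere on that support. -/

/-! ### Integrating out and refilling one coordinate of a product measure. -/

theorem enorm_nnreal_toReal (x : ℝ≥0) : ‖(x : ℝ)‖ₑ = x := by
  rw [Real.enorm_eq_ofReal x.coe_nonneg, ENNReal.ofReal_coe_nnreal]

/-- `U p z` replaces one coordinate of the point `p` by `z`, where the measure `ν` is a product
measure with the factor `μ` in this coordinate. -/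
structure IsCoordinate {Ω Z : Type*} [MeasurableSpace Ω] [MeasurableSpace Z] (ν : Measure Ω)
    (μ : Measure Z) (U : Ω → Z → Ω) : Prop where
  sFinite : SFinite μ
  exists_measurePreserving : ∃ ν' : Measure Ω, SFinite ν' ∧ ν ≪ ν' ∧ ν' ≪ ν ∧
    MeasurePreserving (fun q : Ω × Z => U q.1 q.2) (ν'.prod μ) ν

namespace IsCoordinate

variable {Ω Z S : Type*} [MeasurableSpace Ω] [MeasurableSpace Z] [MeasurableSpace S]
  {ν : Measure Ω} {μ : Measure Z} {U : Ω → Z → Ω}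

/-- Overwriting a coordinate of `μ.prod ρ` itself would multiply mass by the total mass of `μ`,
possibly infinite. The auxiliary measure therefore carries the equivalent probability measure
`μ.toFinite` in the coordinate that is discarded; it has the same null sets, so nothing is lost in
almost-everywhere statements. -/
theorem of_measurableEquiv {W : Type*} [MeasurableSpace W] {ρ : Measure W} [SFinite μ] [NeZero μ]
    [SFinite ρ] (e : Ω ≃ᵐ Z × W) (he : MeasurePreserving e ν (μ.prod ρ))
    (hU : ∀ p z, U p z = e.symm (z, (e p).2)) : IsCoordinate ν μ U := by
  refine ⟨inferInstance, (μ.toFinite.prod ρ).map e.symm, inferInstance, ?_, ?_, ?_⟩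
  · rw [← he.symm.map_eq]
    exact ((absolutelyContinuous_toFinite μ).prod .rfl).map e.symm.measurable
  · conv_rhs => rw [← he.symm.map_eq]
    exact ((toFinite_absolutelyContinuous μ).prod .rfl).map e.symm.measurable
  · have h1 : MeasurePreserving e ((μ.toFinite.prod ρ).map e.symm) (μ.toFinite.prod ρ) :=
      (MeasurePreserving.symm e.symm ⟨e.symm.measurable, rfl⟩)
    have h2 : MeasurePreserving (fun p => (e p).2) ((μ.toFinite.prod ρ).map e.symm) ρ :=
      measurePreserving_snd.comp h1
    have h3 := he.symm.comp (Measure.measurePreserving_swap.comp (h2.prod (.id μ)))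
    convert h3 using 1
    ext q
    simp [hU, Prod.map, Prod.swap]

theorem prod_right (h : IsCoordinate ν μ U) (τ : Measure S) [SFinite τ] :
    IsCoordinate (ν.prod τ) μ fun p z => (U p.1 z, p.2) := by
  obtain ⟨hμ, ν', hν', h1, h2, h3⟩ := h
  refine ⟨hμ, ν'.prod τ, inferInstance, h1.prod .rfl, h2.prod .rfl, ?_⟩
  have h4 : MeasurePreserving (fun q : (Ω × S) × Z => ((q.1.1, q.2), q.1.2))
      ((ν'.prod τ).prod μ) ((ν'.prod μ).prod τ) :=
    (measurePreserving_prodAssoc ν' μ τ).symm.comp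
      (((MeasurePreserving.id ν').prod Measure.measurePreserving_swap).comp
        (measurePreserving_prodAssoc ν' τ μ))
  have h5 : SFinite ν := by rw [← h3.map_eq]; infer_instance
  exact (h3.prod (.id τ)).comp h4

theorem prod_left (h : IsCoordinate ν μ U) (τ : Measure S) [SFinite τ] :
    IsCoordinate (τ.prod ν) μ fun p z => (p.1, U p.2 z) := by
  obtain ⟨hμ, ν', hν', h1, h2, h3⟩ := h
  have h5 : SFinite ν := by rw [← h3.map_eq]; infer_instance
  refine ⟨hμ, τ.prod ν', inferInstance, .prod .rfl h1, .prod .rfl h2, ?_⟩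
  exact ((MeasurePreserving.id τ).prod h3).comp (measurePreserving_prodAssoc τ ν' μ)

theorem ae_section (h : IsCoordinate ν μ U) {P : Ω → Prop} (hP : ∀ᵐ p ∂ν, P p) :
    ∀ᵐ p ∂ν, ∀ᵐ z ∂μ, P (U p z) := by
  obtain ⟨hμ, ν', hν', h1, h2, h3⟩ := h
  exact h1.ae_le (Measure.ae_ae_of_ae_prod (h3.quasiMeasurePreserving.ae hP))

theorem lintegral_le (h : IsCoordinate ν μ U) {F G : Ω → ℝ≥0∞} (hF : Measurable F)
    (hG : Measurable G) (hFG : ∀ᵐ p ∂ν, ∫⁻ z, F (U p z) ∂μ ≤ ∫⁻ z, G (U p z) ∂μ) :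
    ∫⁻ p, F p ∂ν ≤ ∫⁻ p, G p ∂ν := by
  obtain ⟨hμ, ν', hν', h1, h2, h3⟩ := h
  rw [← h3.lintegral_comp hF, ← h3.lintegral_comp hG,
    lintegral_prod (fun q : Ω × Z => F (U q.1 q.2)) (hF.comp h3.measurable).aemeasurable,
    lintegral_prod (fun q : Ω × Z => G (U q.1 q.2)) (hG.comp h3.measurable).aemeasurable]
  exact lintegral_mono_ae (h2.ae_le hFG)

theorem lintegral_congr (h : IsCoordinate ν μ U) {F G : Ω → ℝ≥0∞} (hF : Measurable F)
    (hG : Measurable G) (hFG : ∀ p, ∫⁻ z, F (U p z) ∂μ = ∫⁻ z, G (U p z) ∂μ) :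
    ∫⁻ p, F p ∂ν = ∫⁻ p, G p ∂ν :=
  le_antisymm (h.lintegral_le hF hG (.of_forall fun p => (hFG p).le))
    (h.lintegral_le hG hF (.of_forall fun p => (hFG p).ge))

theorem integrable_section (h : IsCoordinate ν μ U) {F : Ω → ℝ} (hF : Integrable F ν) :
    ∀ᵐ p ∂ν, Integrable (fun z => F (U p z)) μ := by
  obtain ⟨hμ, ν', hν', h1, h2, h3⟩ := h
  exact h1.ae_le (h3.integrable_comp_of_integrable hF).prod_right_ae

theorem integral_congr (h : IsCoordinate ν μ U) {F G : Ω → ℝ} (hF : Integrable F ν)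
    (hG : Integrable G ν) (hFG : ∀ᵐ p ∂ν, ∫ z, F (U p z) ∂μ = ∫ z, G (U p z) ∂μ) :
    ∫ p, F p ∂ν = ∫ p, G p ∂ν := by
  obtain ⟨hμ, ν', hν', h1, h2, h3⟩ := h
  have key : ∀ {H : Ω → ℝ}, Integrable H ν →
      ∫ p, H p ∂ν = ∫ p, ∫ z, H (U p z) ∂μ ∂ν' := by
    intro H hH
    rw [← integral_prod (fun q : Ω × Z => H (U q.1 q.2)) (h3.integrable_comp_of_integrable hH)]
    conv_lhs => rw [← h3.map_eq]
    rw [integral_map h3.aemeasurable]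
    rw [h3.map_eq]
    exact hH.1
  rw [key hF, key hG]
  exact integral_congr_ae (h2.ae_le hFG)

theorem integrable_of_lintegral_le (h : IsCoordinate ν μ U) {F G : Ω → ℝ} (hFm : Measurable F)
    (hG : Measurable G) (hF : Integrable F ν)
    (hFG : ∀ᵐ p ∂ν, ∫⁻ z, ‖G (U p z)‖ₑ ∂μ ≤ ∫⁻ z, ‖F (U p z)‖ₑ ∂μ) : Integrable G ν :=
  ⟨hG.aestronglyMeasurable, (h.lintegral_le hG.enorm hFm.enorm hFG).trans_lt hF.2⟩

/-- Integrating out one coordinate of `F` against the conditional density `u` gives a function `G`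
which does not depend on this coordinate; the conditional density of this coordinate may then be
replaced by any other one. -/
theorem refill (h : IsCoordinate ν μ U) {D₁ D₂ C : Ω → ℝ≥0} {u v : Ω → Z → ℝ≥0} {F G : Ω → ℝ}
    (hD₁ : Measurable D₁) (hD₂ : Measurable D₂) (hFm : Measurable F) (hGm : Measurable G)
    (h₁ : ∀ p z, D₁ (U p z) = u p z * C p) (h₂ : ∀ p z, D₂ (U p z) = v p z * C p)
    (hvm : ∀ p, Measurable (v p)) (hv : ∀ p, ∫⁻ z, (v p z : ℝ≥0∞) ∂μ = 1)
    (hGU : ∀ p z, G (U p z) = G p) (hG : ∀ p, G p = ∫ z, F (U p z) * (u p z : ℝ) ∂μ)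
    (hF : Integrable (fun p => F p * (D₁ p : ℝ)) ν) :
    Integrable (fun p => G p * (D₂ p : ℝ)) ν ∧
      ∫ p, G p * (D₂ p : ℝ) ∂ν = ∫ p, F p * (D₁ p : ℝ) ∂ν := by
  have hvi : ∀ p, ∫ z, (v p z : ℝ) ∂μ = 1 := by
    intro p
    rw [integral_eq_lintegral_of_nonneg_ae (.of_forall fun z => NNReal.coe_nonneg _)
      (hvm p).coe_nnreal_real.aestronglyMeasurable]
    simp [hv p]
  have hint : Integrable (fun p => G p * (D₂ p : ℝ)) ν := by
    refine h.integrable_of_lintegral_le (hFm.mul hD₁.coe_nnreal_real)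
      (hGm.mul hD₂.coe_nnreal_real) hF (.of_forall fun p => ?_)
    calc ∫⁻ z, ‖G (U p z) * (D₂ (U p z) : ℝ)‖ₑ ∂μ
        = ∫⁻ z, (‖G p‖ₑ * (C p : ℝ≥0∞)) * (v p z : ℝ≥0∞) ∂μ := by
          refine MeasureTheory.lintegral_congr fun z => ?_
          rw [hGU, h₂, enorm_mul]
          simp only [NNReal.coe_mul, enorm_mul, enorm_nnreal_toReal]
          ring
      _ = ‖G p‖ₑ * (C p : ℝ≥0∞) := by
          rw [lintegral_const_mul _ (hvm p).coe_nnreal_ennreal, hv, mul_one]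
      _ ≤ (∫⁻ z, ‖F (U p z) * (u p z : ℝ)‖ₑ ∂μ) * (C p : ℝ≥0∞) := by
          gcongr
          rw [hG p]
          exact enorm_integral_le_lintegral_enorm _
      _ = ∫⁻ z, ‖F (U p z) * (D₁ (U p z) : ℝ)‖ₑ ∂μ := by
          rw [← lintegral_mul_const' _ _ ENNReal.coe_ne_top]
          refine MeasureTheory.lintegral_congr fun z => ?_
          rw [h₁]
          simp only [NNReal.coe_mul, enorm_mul, enorm_nnreal_toReal]
          ring
  -- Both section integrals equal `G p * C p`. Sections need not be integrable one by one: constant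
  -- factors leave the Bochner integral in any case, its value being 0 when it diverges.
  refine ⟨hint, h.integral_congr hint hF (.of_forall fun p => ?_)⟩
  calc ∫ z, G (U p z) * (D₂ (U p z) : ℝ) ∂μ = ∫ z, (G p * C p) * (v p z : ℝ) ∂μ := by
        congr 1; ext z; rw [hGU, h₂]; push_cast; ring
    _ = G p * C p := by rw [integral_const_mul, hvi, mul_one]
    _ = ∫ z, F (U p z) * (D₁ (U p z) : ℝ) ∂μ := by
        rw [hG p, ← integral_mul_const]
        congr 1; ext z; rw [h₁]; push_cast; ring

end IsCoordinate

theorem isCoordinate_pi_update {m : ℕ} {Z : Type*} [MeasurableSpace Z] (μ : Measure Z)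
    [SigmaFinite μ] [NeZero μ] (j : Fin (m + 1)) :
    IsCoordinate (Measure.pi fun _ : Fin (m + 1) => μ) μ fun y z => Function.update y j z := by
  refine .of_measurableEquiv (MeasurableEquiv.piFinSuccAbove (fun _ => Z) j)
    (measurePreserving_piFinSuccAbove (fun _ => μ) j) fun y z => ?_
  exact (Fin.insertNth_removeNth j z y).symm

/-! ### Replacing coordinates of panel data, reference densities and truncated densities. -/

namespace PanelModel

section Replace

variable {n : ℕ} {Y X A : Type*}

/-- Replace the outcome with index `j` by `z`. -/
def setY (p : PanelData n Y X × A) (j : Fin (n + 2)) (z : Y) : PanelData n Y X × A :=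
  ((Function.update p.1.1 j z, p.1.2), p.2)

/-- Replace the covariate with index `i` by `z`. -/
def setX (p : PanelData n Y X × A) (i : Fin (n + 1)) (z : X) : PanelData n Y X × A :=
  ((p.1.1, Function.update p.1.2 i z), p.2)

@[simp] theorem setY_self (p : PanelData n Y X × A) (j : Fin (n + 2)) :
    setY p j (p.1.1 j) = p := by
  simp [setY]

@[simp] theorem setY_setY (p : PanelData n Y X × A) (j : Fin (n + 2)) (z z' : Y) :
    setY (setY p j z) j z' = setY p j z' := by
  simp [setY]

@[simp] theorem setX_setX (p : PanelData n Y X × A) (i : Fin (n + 1)) (z z' : X) :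
    setX (setX p i z) i z' = setX p i z' := by
  simp [setX]

/-- `F` is a function of `y_0, …, y_k`, the covariates with index at most `l`, and `a` only. -/
def DependsOnPast {β : Type*} (k l : ℕ) (F : PanelData n Y X × A → β) : Prop :=
  ∀ p p' : PanelData n Y X × A, (∀ j : Fin (n + 2), (j : ℕ) ≤ k → p.1.1 j = p'.1.1 j) →
    (∀ j : Fin (n + 1), (j : ℕ) ≤ l → p.1.2 j = p'.1.2 j) → p.2 = p'.2 → F p = F p'

theorem DependsOnPast.mono {β : Type*} {F : PanelData n Y X × A → β} {k l k' l' : ℕ}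
    (hF : DependsOnPast k l F) (hk : k ≤ k') (hl : l ≤ l') : DependsOnPast k' l' F :=
  fun p p' hy hx ha => hF p p' (fun j hj => hy j (hj.trans hk)) (fun j hj => hx j (hj.trans hl)) ha

theorem DependsOnPast.comp₂ {β γ δ : Type*} {F : PanelData n Y X × A → β}
    {G : PanelData n Y X × A → γ} {k l : ℕ} (hF : DependsOnPast k l F) (hG : DependsOnPast k l G)
    (op : β → γ → δ) : DependsOnPast k l fun p => op (F p) (G p) := by
  intro p p' hy hx ha
  simp only [hF p p' hy hx ha, hG p p' hy hx ha]

theorem DependsOnPast.setX_eq {β : Type*} {F : PanelData n Y X × A → β} {k : ℕ} {i : Fin n}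
    (hF : DependsOnPast k i F) (p : PanelData n Y X × A) (z : X) :
    F (setX p i.succ z) = F p := by
  refine hF _ _ (fun _ _ => rfl) (fun j hj => Function.update_of_ne ?_ _ _) rfl
  rintro rfl
  simp at hj

theorem DependsOnPast.setY_eq {β : Type*} {F : PanelData n Y X × A → β} {l : ℕ} {i : Fin (n + 1)}
    (hF : DependsOnPast i l F) (p : PanelData n Y X × A) (z : Y) :
    F (setY p i.succ z) = F p := by
  refine hF _ _ (fun j hj => Function.update_of_ne ?_ _ _) (fun _ _ => rfl) rfl
  rintro rfl
  simp at hj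

end Replace

variable {n : ℕ} {Θ Y X A : Type*}
  [MeasurableSpace Y] [MeasurableSpace X] [MeasurableSpace A]

theorem measurable_setY (j : Fin (n + 2)) :
    Measurable fun q : (PanelData n Y X × A) × Y => setY q.1 j q.2 := by
  have : Measurable fun q : (PanelData n Y X × A) × Y => Function.update q.1.1.1 j q.2 :=
    (measurable_update' (a := j)).comp (measurable_fst.fst.fst.prodMk measurable_snd)
  exact (this.prodMk measurable_fst.fst.snd).prodMk measurable_fst.snd

theorem measurable_setX (i : Fin (n + 1)) :
    Measurable fun q : (PanelData n Y X × A) × X => setX q.1 i q.2 := by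
  have : Measurable fun q : (PanelData n Y X × A) × X => Function.update q.1.1.2 i q.2 :=
    (measurable_update' (a := i)).comp (measurable_fst.fst.snd.prodMk measurable_snd)
  exact (measurable_fst.fst.fst.prodMk this).prodMk measurable_fst.snd

theorem isCoordinate_setY (M : PanelModel n Θ Y X A) [NeZero M.μY] (j : Fin (n + 2)) :
    IsCoordinate M.refFull M.μY fun p z => setY p j z :=
  ((isCoordinate_pi_update M.μY j).prod_right (Measure.pi fun _ => M.μX)).prod_right M.μA

theorem isCoordinate_setX (M : PanelModel n Θ Y X A) [NeZero M.μX] (i : Fin (n + 1)) :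
    IsCoordinate M.refFull M.μX fun p z => setX p i z :=
  ((isCoordinate_pi_update M.μX i).prod_left (Measure.pi fun _ => M.μY)).prod_right M.μA

/-- Strictly positive reference probability densities for the outcomes, and reference probability
densities for the covariates with the given supports. -/
structure ReferenceDensities (M : PanelModel n Θ Y X A) where
  r : Y → ℝ≥0
  q : Fin n → X → ℝ≥0
  measurable_r : Measurable r
  measurable_q : ∀ i, Measurable (q i)
  lintegral_r : ∫⁻ z, (r z : ℝ≥0∞) ∂M.μY = 1
  lintegral_q : ∀ i, ∫⁻ z, (q i z : ℝ≥0∞) ∂M.μX = 1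
  r_pos : ∀ z, 0 < r z
  q_pos_iff : ∀ i z, 0 < q i z ↔ z ∈ M.cov i

theorem Nuisance.neZero_prod {M : PanelModel n Θ Y X A} (ω : M.Nuisance) :
    M.μY.prod M.μX ≠ 0 := by
  intro h
  have := ω.lintegral_ν
  simp [h] at this

theorem Nuisance.neZero_μY {M : PanelModel n Θ Y X A} (ω : M.Nuisance) : NeZero M.μY :=
  ⟨fun h => ω.neZero_prod (by simp [h])⟩

theorem Nuisance.neZero_μX {M : PanelModel n Θ Y X A} (ω : M.Nuisance) : NeZero M.μX :=
  ⟨fun h => ω.neZero_prod (by simp [h])⟩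

theorem exists_pos_density {Z : Type*} [MeasurableSpace Z] (μ : Measure Z) [SigmaFinite μ]
    [NeZero μ] : ∃ r : Z → ℝ≥0, Measurable r ∧ (∀ z, 0 < r z) ∧ ∫⁻ z, (r z : ℝ≥0∞) ∂μ = 1 := by
  obtain ⟨g, hg0, hgm, hg⟩ := exists_pos_lintegral_lt_of_sigmaFinite μ one_ne_zero
  have hfin : ∫⁻ z, (g z : ℝ≥0∞) ∂μ ≠ ∞ := (hg.trans ENNReal.one_lt_top).ne
  have hne : ∫⁻ z, (g z : ℝ≥0∞) ∂μ ≠ 0 := by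
    rw [Ne, lintegral_eq_zero_iff hgm.coe_nnreal_ennreal]
    intro h
    have : ∀ᵐ z ∂μ, False := h.mono fun z hz => (hg0 z).ne' (by simpa using hz)
    exact NeZero.ne μ (by simpa using this)
  set c : ℝ≥0 := (∫⁻ z, (g z : ℝ≥0∞) ∂μ).toNNReal with hc
  have hcc : (c : ℝ≥0∞) = ∫⁻ z, (g z : ℝ≥0∞) ∂μ := ENNReal.coe_toNNReal hfin
  have hc0 : c ≠ 0 := by
    intro h
    rw [h] at hcc
    exact hne (by simpa using hcc.symm)
  refine ⟨fun z => c⁻¹ * g z, hgm.const_mul _, fun z => mul_pos (by positivity) (hg0 z), ?_⟩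
  simp only [ENNReal.coe_mul]
  rw [lintegral_const_mul _ hgm.coe_nnreal_ennreal, ← hcc, ← ENNReal.coe_mul,
    inv_mul_cancel₀ hc0, ENNReal.coe_one]

theorem Nuisance.nonempty {M : PanelModel n Θ Y X A} (ω : M.Nuisance) :
    Nonempty ((Fin (n + 2) → Y) × (Fin (n + 1) → X) × A) := by
  have hY := ω.neZero_μY
  have hX := ω.neZero_μX
  obtain ⟨y⟩ : Nonempty Y := M.μY.nonempty_of_neZero
  obtain ⟨x⟩ : Nonempty X := M.μX.nonempty_of_neZero
  obtain ⟨a⟩ : Nonempty A := by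
    by_contra h
    rw [not_nonempty_iff] at h
    have := ω.lintegral_π y x
    simp at this
  exact ⟨(fun _ => y, fun _ => x, a)⟩

theorem Nuisance.nonempty_referenceDensities {M : PanelModel n Θ Y X A} (ω : M.Nuisance) :
    Nonempty M.ReferenceDensities := by
  have hY := ω.neZero_μY
  obtain ⟨y, x, a⟩ := ω.nonempty
  obtain ⟨r, hrm, hr0, hr⟩ := exists_pos_density M.μY
  -- The feedback density with its conditioning variables frozen is already a probability density
  -- that is positive exactly on `M.cov i`.
  refine ⟨⟨r, fun i z => ω.g i y (Function.update x i.succ z) a, hrm, fun i => ?_, hr,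
    fun i => ω.lintegral_g i y x a, hr0, fun i z => ?_⟩⟩
  · exact (ω.measurable_g i).comp (measurable_const.prodMk ((measurable_update x).prodMk
      measurable_const))
  · simp [ω.g_pos_iff]

/-- The joint density, with the outcome densities of all but the first `k` periods and the feedback
densities of all but the first `l` periods replaced by the reference densities. -/
def truncDensity (M : PanelModel n Θ Y X A) (θ : Θ) (ω : M.Nuisance) (d : M.ReferenceDensities)
    (k l : ℕ) (p : PanelData n Y X × A) : ℝ≥0 :=
  (∏ i : Fin (n + 1), if (i : ℕ) < k then
      M.f θ i (p.1.1 i.succ) (p.1.1 i.castSucc) (p.1.2 i) p.2 else d.r (p.1.1 i.succ)) *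
    (∏ i : Fin n, if (i : ℕ) < l then ω.g i p.1.1 p.1.2 p.2 else d.q i (p.1.2 i.succ)) *
    ω.π p.2 (p.1.1 0) (p.1.2 0) * ω.ν (p.1.1 0) (p.1.2 0)

variable {M : PanelModel n Θ Y X A} {θ : Θ} {ω : M.Nuisance} {d : M.ReferenceDensities}

theorem truncDensity_full : M.truncDensity θ ω d (n + 1) n = M.jointDensity θ ω := by
  ext p
  rw [truncDensity, jointDensity]
  simp only [Fin.is_lt, if_true]

theorem truncDensity_full_succ (k : ℕ) :
    M.truncDensity θ ω d k (n + 1) = M.truncDensity θ ω d k n := by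
  ext p
  simp [truncDensity, fun i : Fin n => i.2.trans (Nat.lt_succ_self n)]

theorem measurable_outcome_factor (M : PanelModel n Θ Y X A) (θ : Θ) (i : Fin (n + 1)) :
    Measurable fun p : PanelData n Y X × A =>
      M.f θ i (p.1.1 i.succ) (p.1.1 i.castSucc) (p.1.2 i) p.2 :=
  (M.measurable_f θ i).comp
    (f := fun p : PanelData n Y X × A => (p.1.1 i.succ, p.1.1 i.castSucc, p.1.2 i, p.2))
    (by fun_prop)

theorem Nuisance.measurable_feedback (ω : M.Nuisance) (i : Fin n) :
    Measurable fun p : PanelData n Y X × A => ω.g i p.1.1 p.1.2 p.2 :=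
  (ω.measurable_g i).comp
    (f := fun p : PanelData n Y X × A => (p.1.1, p.1.2, p.2)) (by fun_prop)

theorem measurable_truncDensity (k l : ℕ) : Measurable (M.truncDensity θ ω d k l) := by
  refine ((Measurable.mul ?_ ?_).mul ?_).mul ?_
  · refine Finset.measurable_prod _ fun i _ => ?_
    split_ifs
    · exact measurable_outcome_factor M θ i
    · exact d.measurable_r.comp (by fun_prop)
  · refine Finset.measurable_prod _ fun i _ => ?_
    split_ifs
    · exact ω.measurable_feedback i
    · exact (d.measurable_q i).comp (by fun_prop)
  · exact ω.measurable_π.comp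
      (f := fun p : PanelData n Y X × A => (p.2, p.1.1 0, p.1.2 0)) (by fun_prop)
  · exact ω.measurable_ν.comp
      (f := fun p : PanelData n Y X × A => (p.1.1 0, p.1.2 0)) (by fun_prop)

/-- Each `q i` has the same support as the feedback density it replaces, so `l` plays no role, while
`r` is positive everywhere, so only the first `k` outcome densities constrain the point. The support
of `π` is known only over `M.init`, which positivity of `ν` supplies. -/
theorem truncDensity_pos_iff (k : Fin (n + 2)) (l : ℕ) (p : PanelData n Y X × A) :
    0 < M.truncDensity θ ω d k l p ↔ M.InSupport θ k p := by
  have h1 : (0 < ∏ i : Fin (n + 1), if (i : ℕ) < k then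
      M.f θ i (p.1.1 i.succ) (p.1.1 i.castSucc) (p.1.2 i) p.2 else d.r (p.1.1 i.succ)) ↔
      ∀ i : Fin (n + 1), i.succ ≤ k →
        0 < M.f θ i (p.1.1 i.succ) (p.1.1 i.castSucc) (p.1.2 i) p.2 := by
    rw [CanonicallyOrderedAdd.prod_pos]
    refine forall_congr' fun i => ?_
    have : i.succ ≤ k ↔ (i : ℕ) < k := by rw [Fin.le_def, Fin.val_succ, Nat.succ_le_iff]
    by_cases h : (i : ℕ) < k <;> simp [this, h, d.r_pos]
  have h2 : (0 < ∏ i : Fin n, if (i : ℕ) < l then ω.g i p.1.1 p.1.2 p.2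
      else d.q i (p.1.2 i.succ)) ↔ ∀ i : Fin n, p.1.2 i.succ ∈ M.cov i := by
    rw [CanonicallyOrderedAdd.prod_pos]
    refine forall_congr' fun i => ?_
    split_ifs <;> simp [d.q_pos_iff, ω.g_pos_iff]
  have h3 := ω.ν_pos_iff (p.1.1 0) (p.1.2 0)
  simp only [truncDensity, InSupport, CanonicallyOrderedAdd.mul_pos, h1, h2, h3]
  have h4 := ω.π_pos_iff p.2 (p.1.1 0) (p.1.2 0)
  tauto

/-- The other places where `y_{i+1}` could enter are the next outcome density, through its lag, and
the feedback densities with index at least `i`. At truncation levels `(i + 1, i)` and `(i, i)` all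
of these are already replaced, so a single factor sees this coordinate and `C` collects the rest. -/
theorem exists_truncDensity_setY (i : Fin (n + 1)) :
    ∃ C : PanelData n Y X × A → ℝ≥0,
      (∀ p z, M.truncDensity θ ω d (i + 1) i (setY p i.succ z) =
        M.f θ i z (p.1.1 i.castSucc) (p.1.2 i) p.2 * C p) ∧
      ∀ p z, M.truncDensity θ ω d i i (setY p i.succ z) = d.r z * C p := by
  classical
  set Q : PanelData n Y X × A → ℝ≥0 := fun p => ∏ j ∈ Finset.univ.erase i, if (j : ℕ) < i then
    M.f θ j (p.1.1 j.succ) (p.1.1 j.castSucc) (p.1.2 j) p.2 else d.r (p.1.1 j.succ) with hQ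
  set C : PanelData n Y X × A → ℝ≥0 := fun p => Q p *
    (∏ j : Fin n, if (j : ℕ) < i then ω.g j p.1.1 p.1.2 p.2 else d.q j (p.1.2 j.succ)) *
    ω.π p.2 (p.1.1 0) (p.1.2 0) * ω.ν (p.1.1 0) (p.1.2 0) with hC
  have hg : ∀ p z, (∏ j : Fin n, if (j : ℕ) < i then
      ω.g j (setY p i.succ z).1.1 (setY p i.succ z).1.2 (setY p i.succ z).2
      else d.q j ((setY p i.succ z).1.2 j.succ)) =
      ∏ j : Fin n, if (j : ℕ) < i then ω.g j p.1.1 p.1.2 p.2 else d.q j (p.1.2 j.succ) := by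
    intro p z
    refine Finset.prod_congr rfl fun j _ => ?_
    split_ifs with h
    · refine ω.g_past j _ _ _ _ _ (fun m hm => ?_) fun _ _ => rfl
      refine Function.update_of_ne (fun hmi => ?_) _ _
      rw [hmi, Fin.le_def] at hm
      simp only [Fin.val_succ, Fin.val_castSucc] at hm
      omega
    · rfl
  have hf : ∀ k, (k = (i : ℕ) ∨ k = (i : ℕ) + 1) → ∀ p z,
      (∏ j ∈ Finset.univ.erase i, if (j : ℕ) < k then
        M.f θ j ((setY p i.succ z).1.1 j.succ) ((setY p i.succ z).1.1 j.castSucc)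
          ((setY p i.succ z).1.2 j) (setY p i.succ z).2
        else d.r ((setY p i.succ z).1.1 j.succ)) = Q p := by
    intro k hk p z
    refine Finset.prod_congr rfl fun j hj => ?_
    have hji : j ≠ i := Finset.ne_of_mem_erase hj
    have hji' : (j : ℕ) ≠ i := fun h => hji (Fin.ext h)
    have e1 : (setY p i.succ z).1.1 j.succ = p.1.1 j.succ :=
      Function.update_of_ne (fun h => hji (Fin.succ_injective _ h)) _ _
    by_cases h : (j : ℕ) < i
    · have e2 : (setY p i.succ z).1.1 j.castSucc = p.1.1 j.castSucc := by
        refine Function.update_of_ne (fun h' => ?_) _ _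
        have := congrArg Fin.val h'
        simp at this
        omega
      rw [if_pos h, if_pos (by omega), e1, e2]
      rfl
    · rw [if_neg h, if_neg (by omega), e1]
  have h0 : ∀ (p : PanelData n Y X × A) z, (setY p i.succ z).1.1 0 = p.1.1 0 := fun p z =>
    by simp [setY, (Fin.succ_ne_zero i).symm]
  refine ⟨C, fun p z => ?_, fun p z => ?_⟩
  · rw [truncDensity, hg, ← Finset.mul_prod_erase _ _ (Finset.mem_univ i),
      hf _ (.inr rfl), if_pos (Nat.lt_succ_self _), h0, hC]
    have e2 : (setY p i.succ z).1.1 i.castSucc = p.1.1 i.castSucc :=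
      Function.update_of_ne (Fin.castSucc_lt_succ).ne _ _
    rw [e2]
    simp only [setY, Function.update_self]
    ring
  · rw [truncDensity, hg, ← Finset.mul_prod_erase _ _ (Finset.mem_univ i),
      hf _ (.inl rfl), if_neg (lt_irrefl _), h0, hC]
    simp only [setY, Function.update_self]
    ring

/-- The covariate with index `i + 1` enters the outcome densities only from index `i + 1` on and the
feedback densities only from index `i` on. After truncation at `(i + 1, i + 1)` only `g i` is left,
and at `(i + 1, i)` only `q i`. -/
theorem exists_truncDensity_setX (i : Fin n) :
    ∃ C : PanelData n Y X × A → ℝ≥0,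
      (∀ p z, M.truncDensity θ ω d (i + 1) (i + 1) (setX p i.succ z) =
        ω.g i p.1.1 (Function.update p.1.2 i.succ z) p.2 * C p) ∧
      ∀ p z, M.truncDensity θ ω d (i + 1) i (setX p i.succ z) = d.q i z * C p := by
  classical
  set Q : PanelData n Y X × A → ℝ≥0 := fun p => ∏ j ∈ Finset.univ.erase i, if (j : ℕ) < i then
    ω.g j p.1.1 p.1.2 p.2 else d.q j (p.1.2 j.succ) with hQ
  set C : PanelData n Y X × A → ℝ≥0 := fun p =>
    (∏ j : Fin (n + 1), if (j : ℕ) < i + 1 then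
      M.f θ j (p.1.1 j.succ) (p.1.1 j.castSucc) (p.1.2 j) p.2 else d.r (p.1.1 j.succ)) * Q p *
    ω.π p.2 (p.1.1 0) (p.1.2 0) * ω.ν (p.1.1 0) (p.1.2 0) with hC
  have hf : ∀ p z, (∏ j : Fin (n + 1), if (j : ℕ) < i + 1 then
        M.f θ j ((setX p i.succ z).1.1 j.succ) ((setX p i.succ z).1.1 j.castSucc)
          ((setX p i.succ z).1.2 j) (setX p i.succ z).2
        else d.r ((setX p i.succ z).1.1 j.succ)) =
      ∏ j : Fin (n + 1), if (j : ℕ) < i + 1 then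
        M.f θ j (p.1.1 j.succ) (p.1.1 j.castSucc) (p.1.2 j) p.2 else d.r (p.1.1 j.succ) := by
    intro p z
    refine Finset.prod_congr rfl fun j _ => ?_
    split_ifs with h
    · have e2 : (setX p i.succ z).1.2 j = p.1.2 j := by
        refine Function.update_of_ne (fun h' => ?_) _ _
        rw [h', Fin.val_succ] at h
        omega
      rw [e2]
      rfl
    · rfl
  have hg : ∀ k, (k = (i : ℕ) ∨ k = (i : ℕ) + 1) → ∀ p z,
      (∏ j ∈ Finset.univ.erase i, if (j : ℕ) < k then
        ω.g j (setX p i.succ z).1.1 (setX p i.succ z).1.2 (setX p i.succ z).2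
        else d.q j ((setX p i.succ z).1.2 j.succ)) = Q p := by
    intro k hk p z
    refine Finset.prod_congr rfl fun j hj => ?_
    have hji : j ≠ i := Finset.ne_of_mem_erase hj
    have hji' : (j : ℕ) ≠ i := fun h => hji (Fin.ext h)
    by_cases h : (j : ℕ) < i
    · rw [if_pos h, if_pos (by omega)]
      refine ω.g_past j _ _ _ _ _ (fun _ _ => rfl) fun m hm => ?_
      refine Function.update_of_ne (fun hmi => ?_) _ _
      rw [hmi, Fin.le_def] at hm
      simp only [Fin.val_succ] at hm
      omega
    · rw [if_neg h, if_neg (by omega)]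
      exact congrArg _ (Function.update_of_ne (fun h => hji (Fin.succ_injective _ h)) _ _)
  have h0 : ∀ (p : PanelData n Y X × A) z, (setX p i.succ z).1.2 0 = p.1.2 0 := fun p z =>
    by simp [setX, (Fin.succ_ne_zero i).symm]
  refine ⟨C, fun p z => ?_, fun p z => ?_⟩
  · rw [truncDensity, hf, ← Finset.mul_prod_erase _ _ (Finset.mem_univ i),
      hg _ (.inr rfl), if_pos (Nat.lt_succ_self _), h0, hC]
    simp only [setX]
    ring
  · rw [truncDensity, hf, ← Finset.mul_prod_erase _ _ (Finset.mem_univ i),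
      hg _ (.inl rfl), if_neg (lt_irrefl _), h0, hC]
    simp only [setX, Function.update_self]
    ring

/-- By Tonelli the likelihood is the density of a marginal. Means of `φ` thus become integrals over
the full space, where the density is a product. -/
theorem dataLaw_eq_map (M : PanelModel n Θ Y X A) (θ : Θ) (ω : M.Nuisance)
    (hD : Measurable (M.jointDensity θ ω)) :
    M.dataLaw θ ω = (M.jointLaw θ ω).map Prod.fst := by
  ext s hs
  rw [Measure.map_apply measurable_fst hs, dataLaw, withDensity_apply _ hs, jointLaw,
    withDensity_apply _ (measurable_fst hs), ← lintegral_indicator hs,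
    ← lintegral_indicator (measurable_fst hs), refFull, lintegral_prod]
  · refine lintegral_congr fun z => ?_
    by_cases hz : z ∈ s <;> simp [hz, likelihood, Set.indicator]
  · exact (hD.coe_nnreal_ennreal.indicator (measurable_fst hs)).aemeasurable

theorem measurable_jointDensity : Measurable (M.jointDensity θ ω) := by
  obtain ⟨d⟩ := ω.nonempty_referenceDensities
  rw [← truncDensity_full (d := d)]
  exact measurable_truncDensity _ _

theorem integrable_dataLaw_iff {φ : PanelData n Y X → ℝ} (hφ : Measurable φ) :
    Integrable φ (M.dataLaw θ ω) ↔
      Integrable (fun p => φ p.1 * (M.jointDensity θ ω p : ℝ)) M.refFull := by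
  rw [dataLaw_eq_map _ _ _ measurable_jointDensity,
    integrable_map_measure hφ.aestronglyMeasurable measurable_fst.aemeasurable, jointLaw,
    integrable_withDensity_iff_integrable_smul measurable_jointDensity]
  simp [NNReal.smul_def, mul_comm]

theorem integral_dataLaw {φ : PanelData n Y X → ℝ} (hφ : Measurable φ) :
    ∫ z, φ z ∂(M.dataLaw θ ω) = ∫ p, φ p.1 * (M.jointDensity θ ω p : ℝ) ∂M.refFull := by
  rw [dataLaw_eq_map _ _ _ measurable_jointDensity,
    integral_map measurable_fst.aemeasurable hφ.aestronglyMeasurable, jointLaw,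
    integral_withDensity_eq_integral_smul measurable_jointDensity]
  simp [NNReal.smul_def, mul_comm]

end PanelModel

/-! ### One-coordinate means and the sufficiency of the moment restrictions. -/

namespace PanelModel

variable {n : ℕ} {Θ Y X A : Type*}
  [MeasurableSpace Y] [MeasurableSpace X] [MeasurableSpace A]

/-- The conditional mean of `F` given everything but the outcome of the period with index `i`,
computed with the outcome density of this period alone. -/
noncomputable def outcomeMean (M : PanelModel n Θ Y X A) (θ : Θ) (i : Fin (n + 1))
    (F : PanelData n Y X × A → ℝ) (p : PanelData n Y X × A) : ℝ :=
  ∫ z, F (setY p i.succ z) * (M.f θ i z (p.1.1 i.castSucc) (p.1.2 i) p.2 : ℝ) ∂M.μY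

/-- The mean of `F` over the covariate with index `i.succ`, computed with the feedback density of
this covariate alone. -/
noncomputable def feedbackMean (M : PanelModel n Θ Y X A) (ω : M.Nuisance) (i : Fin n)
    (F : PanelData n Y X × A → ℝ) (p : PanelData n Y X × A) : ℝ :=
  ∫ z, F (setX p i.succ z) * (ω.g i p.1.1 (Function.update p.1.2 i.succ z) p.2 : ℝ) ∂M.μX

variable {M : PanelModel n Θ Y X A} {θ : Θ} {ω : M.Nuisance} {d : M.ReferenceDensities}
  {F : PanelData n Y X × A → ℝ}

theorem measurable_outcomeMean (hF : Measurable F) (i : Fin (n + 1)) :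
    Measurable (M.outcomeMean θ i F) := by
  refine StronglyMeasurable.measurable (StronglyMeasurable.integral_prod_right
    (f := fun p z => F (setY p i.succ z) *
      (M.f θ i z (p.1.1 i.castSucc) (p.1.2 i) p.2 : ℝ)) (Measurable.stronglyMeasurable ?_))
  refine (hF.comp (measurable_setY i.succ)).mul (Measurable.coe_nnreal_real ?_)
  exact (M.measurable_f θ i).comp (f := fun q : (PanelData n Y X × A) × Y =>
    (q.2, q.1.1.1 i.castSucc, q.1.1.2 i, q.1.2)) (by fun_prop)

theorem Nuisance.measurable_feedback_section (ω : M.Nuisance) (i : Fin n) :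
    Measurable fun q : (PanelData n Y X × A) × X =>
      ω.g i q.1.1.1 (Function.update q.1.1.2 i.succ q.2) q.1.2 :=
  (ω.measurable_feedback i).comp (measurable_setX i.succ)

theorem Nuisance.measurable_feedback_update (ω : M.Nuisance) (i : Fin n)
    (p : PanelData n Y X × A) :
    Measurable fun z => ω.g i p.1.1 (Function.update p.1.2 i.succ z) p.2 :=
  (ω.measurable_feedback_section i).comp measurable_prodMk_left

theorem measurable_feedbackMean (hF : Measurable F) (i : Fin n) :
    Measurable (M.feedbackMean ω i F) := by
  refine StronglyMeasurable.measurable (StronglyMeasurable.integral_prod_right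
    (f := fun p z => F (setX p i.succ z) *
      (ω.g i p.1.1 (Function.update p.1.2 i.succ z) p.2 : ℝ)) (Measurable.stronglyMeasurable ?_))
  exact (hF.comp (measurable_setX i.succ)).mul
    (ω.measurable_feedback_section i).coe_nnreal_real

theorem outcomeMean_setY (i : Fin (n + 1)) (p : PanelData n Y X × A) (z : Y) :
    M.outcomeMean θ i F (setY p i.succ z) = M.outcomeMean θ i F p := by
  have e2 : (setY p i.succ z).1.1 i.castSucc = p.1.1 i.castSucc :=
    Function.update_of_ne (Fin.castSucc_lt_succ).ne _ _
  simp only [outcomeMean, setY_setY, e2]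
  rfl

theorem feedbackMean_setX (i : Fin n) (p : PanelData n Y X × A) (z : X) :
    M.feedbackMean ω i F (setX p i.succ z) = M.feedbackMean ω i F p := by
  simp only [feedbackMean, setX_setX]
  simp [setX]

theorem outcomeMean_mul {h : PanelData n Y X × A → ℝ} (i : Fin (n + 1))
    (hh : ∀ p z, h (setY p i.succ z) = h p) :
    M.outcomeMean θ i (fun p => F p * h p) = fun p => M.outcomeMean θ i F p * h p := by
  ext p
  rw [outcomeMean, outcomeMean, ← integral_mul_const]
  congr 1
  ext z
  rw [hh]
  ring

theorem feedbackMean_mul {h : PanelData n Y X × A → ℝ} (i : Fin n)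
    (hh : ∀ p z, h (setX p i.succ z) = h p) :
    M.feedbackMean ω i (fun p => F p * h p) = fun p => M.feedbackMean ω i F p * h p := by
  ext p
  rw [feedbackMean, feedbackMean, ← integral_mul_const]
  congr 1
  ext z
  rw [hh]
  ring

/-- Integrating out an outcome. -/
theorem integral_outcomeMean (i : Fin (n + 1)) (hF : Measurable F)
    (hint : Integrable (fun p => F p * (M.truncDensity θ ω d (i + 1) i p : ℝ)) M.refFull) :
    Integrable (fun p => M.outcomeMean θ i F p * (M.truncDensity θ ω d i i p : ℝ)) M.refFull ∧
      ∫ p, M.outcomeMean θ i F p * (M.truncDensity θ ω d i i p : ℝ) ∂M.refFull =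
        ∫ p, F p * (M.truncDensity θ ω d (i + 1) i p : ℝ) ∂M.refFull := by
  have := ω.neZero_μY
  obtain ⟨C, h1, h2⟩ := exists_truncDensity_setY (M := M) (θ := θ) (ω := ω) (d := d) i
  exact (M.isCoordinate_setY i.succ).refill (measurable_truncDensity _ _)
    (measurable_truncDensity _ _) hF (measurable_outcomeMean hF i) h1 h2
    (fun _ => d.measurable_r) (fun _ => d.lintegral_r) (fun p z => outcomeMean_setY i p z)
    (fun _ => rfl) hint

/-- Integrating out a covariate. -/
theorem integral_feedbackMean (i : Fin n) (hF : Measurable F)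
    (hint : Integrable (fun p => F p * (M.truncDensity θ ω d (i + 1) (i + 1) p : ℝ)) M.refFull) :
    Integrable (fun p => M.feedbackMean ω i F p * (M.truncDensity θ ω d (i + 1) i p : ℝ))
        M.refFull ∧
      ∫ p, M.feedbackMean ω i F p * (M.truncDensity θ ω d (i + 1) i p : ℝ) ∂M.refFull =
        ∫ p, F p * (M.truncDensity θ ω d (i + 1) (i + 1) p : ℝ) ∂M.refFull := by
  have := ω.neZero_μX
  obtain ⟨C, h1, h2⟩ := exists_truncDensity_setX (M := M) (θ := θ) (ω := ω) (d := d) i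
  exact (M.isCoordinate_setX i.succ).refill (measurable_truncDensity _ _)
    (measurable_truncDensity _ _) hF (measurable_feedbackMean hF i) h1 h2
    (fun _ => d.measurable_q i) (fun _ => d.lintegral_q i) (fun p z => feedbackMean_setX i p z)
    (fun _ => rfl) hint

/-- `partialIntegral` as a function on the full sample space. -/
noncomputable def momentFun (M : PanelModel n Θ Y X A) (θ : Θ) (φ : PanelData n Y X → ℝ)
    (k : Fin (n + 2)) (p : PanelData n Y X × A) : ℝ :=
  M.partialIntegral θ φ k p.1.1 p.1.2 p.2

variable {φ : PanelData n Y X → ℝ}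

theorem momentFun_last : M.momentFun θ φ (Fin.last (n + 1)) = fun p => φ p.1 := by
  ext p
  simp only [momentFun, partialIntegral, Fin.reverseInduction_last]

theorem momentFun_castSucc (i : Fin (n + 1)) :
    M.momentFun θ φ i.castSucc = M.outcomeMean θ i (M.momentFun θ φ i.succ) := by
  ext p
  simp only [momentFun, partialIntegral, Fin.reverseInduction_castSucc]
  rfl

theorem measurable_momentFun (hφ : Measurable φ) (k : Fin (n + 2)) :
    Measurable (M.momentFun θ φ k) := by
  induction k using Fin.reverseInduction with
  | last => rw [momentFun_last]; exact hφ.comp measurable_fst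
  | cast i ih => rw [momentFun_castSucc]; exact measurable_outcomeMean ih i

theorem inSupport_setX_of_mem (i : Fin n) {p : PanelData n Y X × A}
    (hp : M.InSupport θ i.succ.castSucc p) {z : X} (hz : z ∈ M.cov i) :
    M.InSupport θ i.succ.castSucc (setX p i.succ z) := by
  obtain ⟨h1, h2, h3, h4⟩ := hp
  refine ⟨?_, h2, fun j => ?_, fun j hj => ?_⟩
  · simpa [setX, (Fin.succ_ne_zero i).symm] using h1
  · by_cases hj : j = i
    · subst hj; simpa [setX] using hz
    · have : j.succ ≠ i.succ := fun h => hj (Fin.succ_injective _ h)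
      simpa [setX, this] using h3 j
  · have : j ≠ i.succ := by
      rintro rfl
      rw [Fin.le_def] at hj
      simp at hj
    simpa [setX, this] using h4 j hj

theorem inSupport_setY_of_pos (i : Fin (n + 1)) {p : PanelData n Y X × A}
    (hp : M.InSupport θ i.castSucc p) {z : Y}
    (hz : 0 < M.f θ i z (p.1.1 i.castSucc) (p.1.2 i) p.2) :
    M.InSupport θ i.succ (setY p i.succ z) := by
  obtain ⟨h1, h2, h3, h4⟩ := hp
  refine ⟨?_, h2, h3, fun j hj => ?_⟩
  · simpa [setY, (Fin.succ_ne_zero i).symm] using h1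
  · have e2 : (setY p i.succ z).1.1 j.castSucc = p.1.1 j.castSucc := by
      refine Function.update_of_ne (fun h => ?_) _ _
      have h' := congrArg Fin.val h
      rw [Fin.le_def] at hj
      simp at h' hj
      omega
    rw [e2]
    by_cases h : j = i
    · subst h
      simpa [setY] using hz
    · have e1 : (setY p i.succ z).1.1 j.succ = p.1.1 j.succ :=
        Function.update_of_ne (fun h' => h (Fin.succ_injective _ h')) _ _
      rw [e1]
      refine h4 j ?_
      rw [Fin.le_def] at hj ⊢
      simp only [Fin.val_succ, Fin.val_castSucc] at hj ⊢
      have : (j : ℕ) ≠ i := fun h' => h (Fin.ext h')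
      omega

theorem Nuisance.integral_g (ω : M.Nuisance) (i : Fin n) (p : PanelData n Y X × A) :
    ∫ z, (ω.g i p.1.1 (Function.update p.1.2 i.succ z) p.2 : ℝ) ∂M.μX = 1 := by
  rw [integral_eq_lintegral_of_nonneg_ae (.of_forall fun z => NNReal.coe_nonneg _)
    (ω.measurable_feedback_update i p).coe_nnreal_real.aestronglyMeasurable]
  simp [ω.lintegral_g]

/-- On almost every section the partial integral agrees with `m`, which is constant in the averaged
covariate, and `g` has mass one. Off `M.cov i`, where the restriction says nothing, `g` vanishes. -/
theorem MomentRestrictions.feedbackMean_eq (hM : M.MomentRestrictions θ φ) (ω : M.Nuisance)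
    (i : Fin n) : ∀ᵐ p ∂M.refFull, M.InSupport θ i.succ.castSucc p →
      M.feedbackMean ω i (M.momentFun θ φ i.succ.castSucc) p =
        M.momentFun θ φ i.succ.castSucc p := by
  have := ω.neZero_μX
  obtain ⟨m, hm, hae⟩ := hM.feedback i
  filter_upwards [hae, (M.isCoordinate_setX i.succ).ae_section hae] with p hp hsec hs
  have key : ∀ᵐ z ∂M.μX, M.momentFun θ φ i.succ.castSucc (setX p i.succ z) *
      (ω.g i p.1.1 (Function.update p.1.2 i.succ z) p.2 : ℝ) =
      m p.1.1 p.1.2 p.2 * (ω.g i p.1.1 (Function.update p.1.2 i.succ z) p.2 : ℝ) := by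
    filter_upwards [hsec] with z hz
    by_cases hzc : z ∈ M.cov i
    · rw [momentFun, hz (inSupport_setX_of_mem i hs hzc)]
      congr 1
      refine hm _ _ _ _ _ (fun _ _ => rfl) fun j hj => ?_
      exact Function.update_of_ne hj.ne _ _
    · have : ω.g i p.1.1 (Function.update p.1.2 i.succ z) p.2 = 0 := by
        by_contra h
        have := (ω.g_pos_iff i p.1.1 (Function.update p.1.2 i.succ z) p.2).1 (pos_iff_ne_zero.2 h)
        simp at this
        exact hzc this
      simp [this]
  rw [feedbackMean, integral_congr_ae key, integral_const_mul, ω.integral_g, mul_one]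
  exact (hp hs).symm

/-- Downward induction on `k`: the mean of `φ` equals the integral of the `k`-th partial integral
against the density truncated at `(k, k)`. Each step removes a covariate and then an outcome,
carrying integrability along. -/
theorem isFHR_of_momentRestrictions (hφ : Measurable φ) (hM : M.MomentRestrictions θ φ) :
    M.IsFHR θ φ := by
  intro ω hint
  obtain ⟨d⟩ := ω.nonempty_referenceDensities
  rw [integrable_dataLaw_iff hφ] at hint
  rw [integral_dataLaw hφ]
  have main : ∀ k : Fin (n + 2),
      Integrable (fun p => M.momentFun θ φ k p * (M.truncDensity θ ω d k k p : ℝ)) M.refFull ∧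
      ∫ p, M.momentFun θ φ k p * (M.truncDensity θ ω d k k p : ℝ) ∂M.refFull =
        ∫ p, φ p.1 * (M.jointDensity θ ω p : ℝ) ∂M.refFull := by
    intro k
    induction k using Fin.reverseInduction with
    | last =>
      simp only [momentFun_last, Fin.val_last, truncDensity_full_succ, truncDensity_full]
      exact ⟨hint, trivial⟩
    | cast i ih =>
      have step : Integrable (fun p => M.momentFun θ φ i.succ p *
            (M.truncDensity θ ω d (i + 1) i p : ℝ)) M.refFull ∧
          ∫ p, M.momentFun θ φ i.succ p * (M.truncDensity θ ω d (i + 1) i p : ℝ) ∂M.refFull =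
            ∫ p, φ p.1 * (M.jointDensity θ ω p : ℝ) ∂M.refFull := by
        -- No covariate follows `y_T`, so the first descent step integrates out an outcome only.
        induction i using Fin.lastCases with
        | last =>
          simpa only [Fin.val_succ, Fin.val_last, truncDensity_full_succ] using ih
        | cast j =>
          simp only [Fin.succ_castSucc, Fin.val_castSucc, Fin.val_succ] at ih ⊢
          obtain ⟨h1, h2⟩ := integral_feedbackMean j (measurable_momentFun hφ _) ih.1
          have hae : (fun p => M.feedbackMean ω j (M.momentFun θ φ j.succ.castSucc) p *
              (M.truncDensity θ ω d (j + 1) j p : ℝ)) =ᵐ[M.refFull]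
              fun p => M.momentFun θ φ j.succ.castSucc p *
                (M.truncDensity θ ω d (j + 1) j p : ℝ) := by
            filter_upwards [hM.feedbackMean_eq ω j] with p hp
            rcases eq_or_ne (M.truncDensity θ ω d (j + 1) j p) 0 with h0 | h0
            · simp [h0]
            · rw [hp ((truncDensity_pos_iff j.succ.castSucc j p).1 (pos_iff_ne_zero.2 h0))]
          exact ⟨h1.congr hae, by rw [← integral_congr_ae hae, h2, ih.2]⟩
      obtain ⟨h1, h2⟩ := integral_outcomeMean i (measurable_momentFun hφ _) step.1
      rw [momentFun_castSucc]
      exact ⟨h1, h2.trans step.2⟩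
  rw [← (main 0).2]
  refine integral_eq_zero_of_ae ?_
  filter_upwards [hM.hetero] with p hp
  rcases eq_or_ne (M.truncDensity θ ω d ((0 : Fin (n + 2)) : ℕ) ((0 : Fin (n + 2)) : ℕ) p) 0
    with h0 | h0
  · simp only [h0]; simp
  · rw [momentFun, hp ((truncDensity_pos_iff 0 _ p).1 (pos_iff_ne_zero.2 h0))]
    simp

end PanelModel

/-! ### Total mass of the joint density, and tilted nuisance parameters. -/

namespace PanelModel

/-- Split off coordinate 0; the remaining product has the same shape, with `s 0` in the role of `h`.
This is why the induction keeps `h` general. -/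
theorem lintegral_pi_prod_succ_mul {Z : Type*} [MeasurableSpace Z] (μ : Measure Z) [SigmaFinite μ]
    {m : ℕ} (s : Fin m → Z → ℝ≥0∞) (hs : ∀ i, Measurable (s i)) (h1 : ∀ i, ∫⁻ z, s i z ∂μ = 1)
    (h : Z → ℝ≥0∞) (hh : Measurable h) :
    ∫⁻ y, (∏ i : Fin m, s i (y i.succ)) * h (y 0) ∂(Measure.pi fun _ : Fin (m + 1) => μ) =
      ∫⁻ z, h z ∂μ := by
  have split : ∀ {m : ℕ} (G : (Fin m → Z) → ℝ≥0∞) (h : Z → ℝ≥0∞), Measurable G → Measurable h →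
      ∫⁻ y, G (fun i => y i.succ) * h (y 0) ∂(Measure.pi fun _ : Fin (m + 1) => μ) =
        (∫⁻ z, h z ∂μ) * ∫⁻ w, G w ∂(Measure.pi fun _ : Fin m => μ) := by
    intro m G h hG hh
    rw [← lintegral_prod_mul hh.aemeasurable hG.aemeasurable]
    refine Eq.trans (lintegral_congr fun y => ?_)
      ((measurePreserving_piFinSuccAbove (fun _ : Fin (m + 1) => μ) 0).lintegral_comp
        (f := fun q => h q.1 * G q.2) ((hh.comp measurable_fst).mul (hG.comp measurable_snd)))
    rw [mul_comm]
    rfl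
  induction m generalizing h with
  | zero =>
    rw [split (fun w => ∏ i : Fin 0, s i (w i)) h (by simp) hh]
    simp
  | succ m ih =>
    rw [split (fun w => ∏ i : Fin (m + 1), s i (w i)) h
      (Finset.measurable_prod _ fun i _ => (hs i).comp (measurable_pi_apply i)) hh]
    have : ∀ w : Fin (m + 1) → Z, ∏ i : Fin (m + 1), s i (w i) =
        (∏ i : Fin m, s i.succ (w i.succ)) * s 0 (w 0) := fun w => by
      rw [Fin.prod_univ_succ, mul_comm]
    simp only [this]
    rw [ih (fun i => s i.succ) (fun i => hs _) (fun i => h1 _) (s 0) (hs 0), h1, mul_one]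

variable {n : ℕ} {Θ Y X A : Type*}
  [MeasurableSpace Y] [MeasurableSpace X] [MeasurableSpace A]
  {M : PanelModel n Θ Y X A} {θ : Θ} {ω : M.Nuisance} {d : M.ReferenceDensities}

theorem lintegral_truncDensity_zero :
    ∫⁻ p, (M.truncDensity θ ω d 0 0 p : ℝ≥0∞) ∂M.refFull = 1 := by
  rw [refFull, lintegral_prod _ (measurable_truncDensity 0 0).coe_nnreal_ennreal.aemeasurable]
  have h1 : ∀ z : PanelData n Y X, ∫⁻ a, (M.truncDensity θ ω d 0 0 (z, a) : ℝ≥0∞) ∂M.μA =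
      (∏ i : Fin (n + 1), (d.r (z.1 i.succ) : ℝ≥0∞)) *
        ((∏ i : Fin n, (d.q i (z.2 i.succ) : ℝ≥0∞)) * (ω.ν (z.1 0) (z.2 0) : ℝ≥0∞)) := by
    intro z
    have : ∀ a, (M.truncDensity θ ω d 0 0 (z, a) : ℝ≥0∞) =
        ((∏ i : Fin (n + 1), (d.r (z.1 i.succ) : ℝ≥0∞)) *
        ((∏ i : Fin n, (d.q i (z.2 i.succ) : ℝ≥0∞)) * (ω.ν (z.1 0) (z.2 0) : ℝ≥0∞))) *
        (ω.π a (z.1 0) (z.2 0) : ℝ≥0∞) := by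
      intro a
      simp only [truncDensity, not_lt_zero, if_false, ENNReal.coe_mul, ENNReal.ofNNReal_finsetProd]
      ring
    simp only [this]
    rw [lintegral_const_mul, ω.lintegral_π, mul_one]
    exact (ω.measurable_π.comp (f := fun a => (a, z.1 0, z.2 0)) (by fun_prop)).coe_nnreal_ennreal
  simp only [h1]
  have hr : Measurable fun y => (d.r y : ℝ≥0∞) := d.measurable_r.coe_nnreal_ennreal
  have hq : ∀ i, Measurable fun x => (d.q i x : ℝ≥0∞) := fun i =>
    (d.measurable_q i).coe_nnreal_ennreal
  have hν : Measurable fun p : Y × X => (ω.ν p.1 p.2 : ℝ≥0∞) := ω.measurable_ν.coe_nnreal_ennreal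
  rw [refData, lintegral_prod]
  · have h2 : ∀ y : Fin (n + 2) → Y, ∫⁻ x, (∏ i : Fin (n + 1), (d.r (y i.succ) : ℝ≥0∞)) *
        ((∏ i : Fin n, (d.q i (x i.succ) : ℝ≥0∞)) * (ω.ν (y 0) (x 0) : ℝ≥0∞))
          ∂(Measure.pi fun _ : Fin (n + 1) => M.μX) =
        (∏ i : Fin (n + 1), (d.r (y i.succ) : ℝ≥0∞)) * ∫⁻ x, (ω.ν (y 0) x : ℝ≥0∞) ∂M.μX := by
      intro y
      have hνy : Measurable fun x => (ω.ν (y 0) x : ℝ≥0∞) := hν.comp measurable_prodMk_left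
      rw [lintegral_const_mul, lintegral_pi_prod_succ_mul M.μX (fun i x => (d.q i x : ℝ≥0∞)) hq
        d.lintegral_q (fun x => (ω.ν (y 0) x : ℝ≥0∞)) hνy]
      exact (Finset.measurable_prod _ fun i _ => (hq i).comp (measurable_pi_apply _)).mul
        (hνy.comp (measurable_pi_apply 0))
    simp only [h2]
    rw [lintegral_pi_prod_succ_mul M.μY (fun _ y => (d.r y : ℝ≥0∞)) (fun _ => hr)
      (fun _ => d.lintegral_r) (fun y => ∫⁻ x, (ω.ν y x : ℝ≥0∞) ∂M.μX) hν.lintegral_prod_right',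
      ← lintegral_prod (fun p : Y × X => (ω.ν p.1 p.2 : ℝ≥0∞)) hν.aemeasurable, ω.lintegral_ν]
  · refine Measurable.aemeasurable ?_
    refine (Finset.measurable_prod _ fun i _ => hr.comp (by fun_prop)).mul
      ((Finset.measurable_prod _ fun i _ => (hq i).comp (by fun_prop)).mul ?_)
    exact hν.comp (f := fun z : PanelData n Y X => (z.1 0, z.2 0)) (by fun_prop)

/-- The same descent applied to the constant 1: exchanging one conditional density for a reference
density preserves mass, and the fully truncated density can be integrated directly. -/
theorem lintegral_jointDensity : ∫⁻ p, (M.jointDensity θ ω p : ℝ≥0∞) ∂M.refFull = 1 := by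
  obtain ⟨d⟩ := ω.nonempty_referenceDensities
  have hY := ω.neZero_μY
  have hX := ω.neZero_μX
  have main : ∀ k : Fin (n + 2), ∫⁻ p, (M.truncDensity θ ω d k k p : ℝ≥0∞) ∂M.refFull =
      ∫⁻ p, (M.jointDensity θ ω p : ℝ≥0∞) ∂M.refFull := by
    intro k
    induction k using Fin.reverseInduction with
    | last => simp only [Fin.val_last, truncDensity_full_succ, truncDensity_full]
    | cast i ih =>
      have step : ∫⁻ p, (M.truncDensity θ ω d (i + 1) i p : ℝ≥0∞) ∂M.refFull =
          ∫⁻ p, (M.jointDensity θ ω p : ℝ≥0∞) ∂M.refFull := by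
        induction i using Fin.lastCases with
        | last => simpa only [Fin.val_succ, Fin.val_last, truncDensity_full_succ] using ih
        | cast j =>
          simp only [Fin.val_castSucc, Fin.val_succ] at ih ⊢
          rw [← ih]
          obtain ⟨C, h1, h2⟩ := exists_truncDensity_setX (M := M) (θ := θ) (ω := ω) (d := d) j
          refine (M.isCoordinate_setX j.succ).lintegral_congr
            (measurable_truncDensity _ _).coe_nnreal_ennreal
            (measurable_truncDensity _ _).coe_nnreal_ennreal fun p => ?_
          simp only [h1, h2, ENNReal.coe_mul]
          rw [lintegral_mul_const' _ _ ENNReal.coe_ne_top,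
            lintegral_mul_const' _ _ ENNReal.coe_ne_top, ω.lintegral_g, d.lintegral_q]
      rw [← step, Fin.val_castSucc]
      obtain ⟨C, h1, h2⟩ := exists_truncDensity_setY (M := M) (θ := θ) (ω := ω) (d := d) i
      refine (M.isCoordinate_setY i.succ).lintegral_congr
        (measurable_truncDensity _ _).coe_nnreal_ennreal
        (measurable_truncDensity _ _).coe_nnreal_ennreal fun p => ?_
      simp only [h1, h2, ENNReal.coe_mul]
      rw [lintegral_mul_const' _ _ ENNReal.coe_ne_top,
        lintegral_mul_const' _ _ ENNReal.coe_ne_top, M.lintegral_f, d.lintegral_r]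
  rw [← main 0]
  exact lintegral_truncDensity_zero

theorem isProbabilityMeasure_dataLaw (M : PanelModel n Θ Y X A) (θ : Θ) (ω : M.Nuisance) :
    IsProbabilityMeasure (M.dataLaw θ ω) := by
  rw [dataLaw_eq_map _ _ _ measurable_jointDensity]
  have : IsProbabilityMeasure (M.jointLaw θ ω) :=
    ⟨by rw [jointLaw, withDensity_apply _ .univ, setLIntegral_univ, lintegral_jointDensity]⟩
  exact Measure.isProbabilityMeasure_map measurable_fst.aemeasurable

/-- The nuisance parameter with the feedback density of index `i` multiplied by `u`. -/
noncomputable def Nuisance.tiltFeedback (ω : M.Nuisance) (i : Fin n)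
    (u : PanelData n Y X × A → ℝ≥0) (hu : Measurable u) (hpast : DependsOnPast (i + 1) (i + 1) u)
    (hpos : ∀ p, 0 < u p)
    (hint : ∀ p, ∫⁻ z, ((ω.g i p.1.1 (Function.update p.1.2 i.succ z) p.2 *
      u (setX p i.succ z) : ℝ≥0) : ℝ≥0∞) ∂M.μX = 1) : M.Nuisance where
  g j y x a := ω.g j y x a * if j = i then u ((y, x), a) else 1
  π := ω.π
  ν := ω.ν
  measurable_g j := by
    refine (ω.measurable_g j).mul ?_
    split_ifs
    · exact hu.comp (f := fun p : (Fin (n + 2) → Y) × (Fin (n + 1) → X) × A =>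
        ((p.1, p.2.1), p.2.2)) (by fun_prop)
    · exact measurable_const
  measurable_π := ω.measurable_π
  measurable_ν := ω.measurable_ν
  g_past j y y' x x' a hy hx := by
    rw [ω.g_past j y y' x x' a hy hx]
    split_ifs with h
    · subst h
      congr 1
      refine hpast _ _ (fun m hm => hy m ?_) (fun m hm => hx m ?_) rfl
      · rw [Fin.le_def]; simpa using hm
      · rw [Fin.le_def]; simpa using hm
    · rfl
  lintegral_g j y x a := by
    by_cases h : j = i
    · subst h
      simpa [setX] using hint ((y, x), a)
    · simpa [h] using ω.lintegral_g j y x a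
  lintegral_π := ω.lintegral_π
  lintegral_ν := ω.lintegral_ν
  g_pos_iff j y x a := by
    rw [← ω.g_pos_iff j y x a, CanonicallyOrderedAdd.mul_pos]
    split_ifs <;> simp [hpos]
  π_pos_iff := ω.π_pos_iff
  ν_pos_iff := ω.ν_pos_iff

theorem jointDensity_tiltFeedback (ω : M.Nuisance) (i : Fin n) (u : PanelData n Y X × A → ℝ≥0)
    (hu hpast hpos hint) (p : PanelData n Y X × A) :
    M.jointDensity θ (ω.tiltFeedback i u hu hpast hpos hint) p = M.jointDensity θ ω p * u p := by
  simp only [jointDensity, Nuisance.tiltFeedback, Finset.prod_mul_distrib, Finset.prod_ite_eq',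
    Finset.mem_univ, if_true]
  ring

/-- The joint law of `(A, Y_0, X_1)` can be tilted by any function bounded away from zero and
infinity. -/
theorem Nuisance.exists_tilt_initial (ω : M.Nuisance) (u : A → Y → X → ℝ≥0)
    (hu : Measurable fun p : A × Y × X => u p.1 p.2.1 p.2.2) {c C : ℝ≥0} (hc : 0 < c)
    (huc : ∀ a y x, c ≤ u a y x) (huC : ∀ a y x, u a y x ≤ C) :
    ∃ (ω' : M.Nuisance) (Z : ℝ≥0), 0 < Z ∧ ∀ (θ : Θ) p,
      M.jointDensity θ ω' p = M.jointDensity θ ω p * (u p.2 (p.1.1 0) (p.1.2 0) * Z⁻¹) := by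
  have hm : Measurable fun p : A × Y × X => (ω.π p.1 p.2.1 p.2.2 * u p.1 p.2.1 p.2.2 : ℝ≥0) :=
    ω.measurable_π.mul hu
  -- The tilted joint law is factored again: `I` normalises the conditional density of `a` and is
  -- moved into `ν`, where it cancels in the product, leaving the single constant `J`. The bounds on
  -- `u` keep `I` and `J` positive and finite.
  set I : Y × X → ℝ≥0∞ := fun q => ∫⁻ a, ((ω.π a q.1 q.2 * u a q.1 q.2 : ℝ≥0) : ℝ≥0∞) ∂M.μA with hI
  have hIm : Measurable I := hm.coe_nnreal_ennreal.lintegral_prod_left'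
  have hπ : ∀ q : Y × X, Measurable fun a => (ω.π a q.1 q.2 : ℝ≥0∞) := fun q =>
    (ω.measurable_π.comp measurable_prodMk_right).coe_nnreal_ennreal
  have hIc : ∀ q, (c : ℝ≥0∞) ≤ I q := fun q => by
    calc (c : ℝ≥0∞) = ∫⁻ a, (ω.π a q.1 q.2 : ℝ≥0∞) * c ∂M.μA := by
          rw [lintegral_mul_const _ (hπ q), ω.lintegral_π, one_mul]
      _ ≤ I q := lintegral_mono fun a => by
          rw [← ENNReal.coe_mul]
          exact ENNReal.coe_le_coe.2 (mul_le_mul_right (huc _ _ _) _)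
  have hIC : ∀ q, I q ≤ C := fun q => by
    calc I q ≤ ∫⁻ a, (ω.π a q.1 q.2 : ℝ≥0∞) * C ∂M.μA := lintegral_mono fun a => by
          rw [← ENNReal.coe_mul]
          exact ENNReal.coe_le_coe.2 (mul_le_mul_right (huC _ _ _) _)
      _ = C := by rw [lintegral_mul_const _ (hπ q), ω.lintegral_π, one_mul]
  have hIt : ∀ q, ((I q).toNNReal : ℝ≥0∞) = I q := fun q =>
    ENNReal.coe_toNNReal ((hIC q).trans_lt ENNReal.coe_lt_top).ne
  have hI0 : ∀ q, 0 < (I q).toNNReal := fun q => by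
    rw [← ENNReal.coe_pos, hIt]
    exact (ENNReal.coe_pos.2 hc).trans_le (hIc q)
  set J : ℝ≥0∞ := ∫⁻ q, ((ω.ν q.1 q.2 * (I q).toNNReal : ℝ≥0) : ℝ≥0∞) ∂(M.μY.prod M.μX) with hJ
  have hν : Measurable fun q : Y × X => (ω.ν q.1 q.2 : ℝ≥0∞) := ω.measurable_ν.coe_nnreal_ennreal
  have hJc : (c : ℝ≥0∞) ≤ J := by
    calc (c : ℝ≥0∞) = ∫⁻ q, (ω.ν q.1 q.2 : ℝ≥0∞) * c ∂(M.μY.prod M.μX) := by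
          rw [lintegral_mul_const _ hν, ω.lintegral_ν, one_mul]
      _ ≤ J := lintegral_mono fun q => by
          rw [ENNReal.coe_mul, hIt]
          exact mul_le_mul_right (hIc _) _
  have hJC : J ≤ C := by
    calc J ≤ ∫⁻ q, (ω.ν q.1 q.2 : ℝ≥0∞) * C ∂(M.μY.prod M.μX) := lintegral_mono fun q => by
          rw [ENNReal.coe_mul, hIt]
          exact mul_le_mul_right (hIC _) _
      _ = C := by rw [lintegral_mul_const _ hν, ω.lintegral_ν, one_mul]
  have hJt : (J.toNNReal : ℝ≥0∞) = J := ENNReal.coe_toNNReal (hJC.trans_lt ENNReal.coe_lt_top).ne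
  have hJ0 : 0 < J.toNNReal := by
    rw [← ENNReal.coe_pos, hJt]
    exact (ENNReal.coe_pos.2 hc).trans_le hJc
  have hu0 : ∀ a y x, 0 < u a y x := fun a y x => hc.trans_le (huc a y x)
  refine ⟨{
    g := ω.g
    π := fun a y x => ω.π a y x * u a y x * ((I (y, x)).toNNReal)⁻¹
    ν := fun y x => ω.ν y x * (I (y, x)).toNNReal * (J.toNNReal)⁻¹
    measurable_g := ω.measurable_g
    measurable_π := hm.mul (hIm.ennreal_toNNReal.comp measurable_snd).inv
    measurable_ν := (ω.measurable_ν.mul hIm.ennreal_toNNReal).mul measurable_const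
    g_past := ω.g_past
    lintegral_g := ω.lintegral_g
    lintegral_π := fun y x => ?_
    lintegral_ν := ?_
    g_pos_iff := ω.g_pos_iff
    π_pos_iff := fun a y x h => ?_
    ν_pos_iff := fun y x => ?_ }, J.toNNReal, hJ0, fun θ p => ?_⟩
  · simp only [ENNReal.coe_mul (_ * _) _]
    rw [lintegral_mul_const' _ _ ENNReal.coe_ne_top]
    change I (y, x) * _ = 1
    rw [← hIt, ← ENNReal.coe_mul, ENNReal.toNNReal_coe, mul_inv_cancel₀ (hI0 _).ne', ENNReal.coe_one]
  · simp only [ENNReal.coe_mul (_ * _) _]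
    rw [lintegral_mul_const' _ _ ENNReal.coe_ne_top]
    change J * _ = 1
    rw [← hJt, ← ENNReal.coe_mul, ENNReal.toNNReal_coe, mul_inv_cancel₀ hJ0.ne', ENNReal.coe_one]
  · rw [← ω.π_pos_iff a y x h]
    simp only [CanonicallyOrderedAdd.mul_pos, hu0, inv_pos, hI0, and_true]
  · rw [← ω.ν_pos_iff y x]
    simp only [CanonicallyOrderedAdd.mul_pos, inv_pos, hI0, hJ0, and_true]
  · simp only [jointDensity]
    have := (hI0 (p.1.1 0, p.1.2 0)).ne'
    field_simp

end PanelModel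

/-! ### Necessity: orthogonality to scores and descent of conditional means. -/

namespace PanelModel

variable {n : ℕ} {Θ Y X A : Type*}
  [MeasurableSpace Y] [MeasurableSpace X] [MeasurableSpace A]
  {M : PanelModel n Θ Y X A} {θ : Θ} {ω : M.Nuisance} {d : M.ReferenceDensities}
  {φ : PanelData n Y X → ℝ} {F h χ : PanelData n Y X × A → ℝ}

theorem DependsOnPast.feedbackMean {i : Fin n} (hF : DependsOnPast (i + 1) (i + 1) F) :
    DependsOnPast (i + 1) i (M.feedbackMean ω i F) := by
  intro p p' hy hx ha
  have hx' : ∀ z, ∀ j : Fin (n + 1), (j : ℕ) ≤ i + 1 →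
      Function.update p.1.2 i.succ z j = Function.update p'.1.2 i.succ z j := by
    intro z j hj
    by_cases h : j = i.succ
    · subst h; simp
    · have : (j : ℕ) ≠ i + 1 := fun h' => h (Fin.ext (by simpa using h'))
      simp only [Function.update_of_ne h]
      exact hx j (by omega)
  simp only [PanelModel.feedbackMean]
  congr 1
  ext z
  rw [hF (setX p i.succ z) (setX p' i.succ z) hy (hx' z) ha,
    ω.g_past i p.1.1 p'.1.1 (Function.update p.1.2 i.succ z) (Function.update p'.1.2 i.succ z) p.2
      (fun j hj => hy j (by rw [Fin.le_def] at hj; simpa using hj))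
      (fun j hj => hx' z j (by rw [Fin.le_def] at hj; simpa using hj)), ha]

theorem DependsOnPast.outcomeMean {i : Fin (n + 1)} (hF : DependsOnPast (i + 1) i F) :
    DependsOnPast i i (M.outcomeMean θ i F) := by
  intro p p' hy hx ha
  have hy' : ∀ z, ∀ j : Fin (n + 2), (j : ℕ) ≤ i + 1 →
      Function.update p.1.1 i.succ z j = Function.update p'.1.1 i.succ z j := by
    intro z j hj
    by_cases h : j = i.succ
    · subst h; simp
    · have : (j : ℕ) ≠ i + 1 := fun h' => h (Fin.ext (by simpa using h'))
      simp only [Function.update_of_ne h]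
      exact hy j (by omega)
  simp only [PanelModel.outcomeMean]
  congr 1
  ext z
  rw [hF (setY p i.succ z) (setY p' i.succ z) (hy' z) hx ha,
    hy i.castSucc (by simp), hx i le_rfl, ha]

theorem Nuisance.integrable_g (ω : M.Nuisance) (i : Fin n) (p : PanelData n Y X × A) :
    Integrable (fun z => (ω.g i p.1.1 (Function.update p.1.2 i.succ z) p.2 : ℝ)) M.μX :=
  .of_integral_ne_zero (by rw [ω.integral_g]; exact one_ne_zero)

theorem Nuisance.integrable_mul_g (ω : M.Nuisance) (i : Fin n) (p : PanelData n Y X × A)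
    (hh : Measurable h) {B : ℝ} (hB : ∀ p, |h p| ≤ B) :
    Integrable (fun z => h (setX p i.succ z) *
      (ω.g i p.1.1 (Function.update p.1.2 i.succ z) p.2 : ℝ)) M.μX :=
  (ω.integrable_g i p).bdd_mul
    (hh.comp ((measurable_setX i.succ).comp measurable_prodMk_left)).aestronglyMeasurable
    (.of_forall fun _ => hB _)

theorem abs_feedbackMean_le {B : ℝ} (hB : ∀ p, |h p| ≤ B) (i : Fin n)
    (p : PanelData n Y X × A) : |M.feedbackMean ω i h p| ≤ B := by
  have := norm_integral_le_of_norm_le ((ω.integrable_g i p).const_mul B)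
    (f := fun z => h (setX p i.succ z) *
      (ω.g i p.1.1 (Function.update p.1.2 i.succ z) p.2 : ℝ)) (.of_forall fun z => by
    rw [norm_mul, Real.norm_eq_abs, Real.norm_eq_abs, NNReal.abs_eq]
    exact mul_le_mul_of_nonneg_right (hB _) (NNReal.coe_nonneg _))
  rwa [integral_const_mul, ω.integral_g, mul_one] at this

theorem integrable_mul_of_bdd (hint : Integrable F M.refFull) (hh : Measurable h) {B : ℝ}
    (hB : ∀ p, |h p| ≤ B) : Integrable (fun p => F p * h p) M.refFull :=
  hint.mul_bdd hh.aestronglyMeasurable (.of_forall hB)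

/-- Tilting the feedback process: under the FHR property, `φ` is orthogonal to every feedback
score. -/
theorem IsFHR.integral_feedback_score_eq_zero (hFHR : M.IsFHR θ φ) (hφ : Measurable φ)
    (hint : Integrable (fun p => φ p.1 * (M.jointDensity θ ω p : ℝ)) M.refFull) (i : Fin n)
    (hh : Measurable h) (h1 : ∀ p, |h p| ≤ 1) (hpast : DependsOnPast (i + 1) (i + 1) h) :
    ∫ p, φ p.1 * (M.jointDensity θ ω p : ℝ) * (h p - M.feedbackMean ω i h p) ∂M.refFull = 0 := by
  set E := M.feedbackMean ω i h with hE
  have hE1 : ∀ p, |E p| ≤ 1 := abs_feedbackMean_le h1 i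
  have hEm : Measurable E := measurable_feedbackMean hh i
  have hb : ∀ p, |h p - E p| ≤ 2 := fun p => by
    have := abs_sub (h p) (E p)
    linarith [h1 p, hE1 p]
  have hpos : ∀ p, (0 : ℝ) < 1 + (h p - E p) / 4 := fun p => by
    have := (abs_le.1 (hb p)).1
    linarith
  -- Since `|h - E| ≤ 2`, the divisor 4 keeps the tilt at least `1/2`; centring by `E` gives it
  -- conditional mean one under `g`.
  set u : PanelData n Y X × A → ℝ≥0 := fun p => Real.toNNReal (1 + (h p - E p) / 4) with hu
  have huc : ∀ p, (u p : ℝ) = 1 + (h p - E p) / 4 := fun p => Real.coe_toNNReal _ (hpos p).le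
  have hum : Measurable u :=
    (measurable_const.add ((hh.sub hEm).div_const 4)).real_toNNReal
  have hup : DependsOnPast (i + 1) (i + 1) u :=
    hpast.comp₂ (hpast.feedbackMean.mono le_rfl (Nat.le_succ _))
      fun s t => Real.toNNReal (1 + (s - t) / 4)
  have hui : ∀ p, ∫⁻ z, ((ω.g i p.1.1 (Function.update p.1.2 i.succ z) p.2 *
      u (setX p i.succ z) : ℝ≥0) : ℝ≥0∞) ∂M.μX = 1 := by
    intro p
    have e : ∀ z, ((ω.g i p.1.1 (Function.update p.1.2 i.succ z) p.2 *
        u (setX p i.succ z) : ℝ≥0) : ℝ) =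
        (1 - E p / 4) * (ω.g i p.1.1 (Function.update p.1.2 i.succ z) p.2 : ℝ) +
        (1 / 4) * (h (setX p i.succ z) *
          (ω.g i p.1.1 (Function.update p.1.2 i.succ z) p.2 : ℝ)) := by
      intro z
      rw [NNReal.coe_mul, huc, hE, feedbackMean_setX]
      ring
    have i1 := (ω.integrable_g i p).const_mul (1 - E p / 4)
    have i2 := (ω.integrable_mul_g i p hh h1).const_mul (1 / 4)
    rw [lintegral_coe_eq_integral _ (by simp only [e]; exact i1.add i2)]
    simp only [e]
    rw [integral_add i1 i2, integral_const_mul, integral_const_mul, ω.integral_g]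
    change ENNReal.ofReal ((1 - E p / 4) * 1 + 1 / 4 * E p) = 1
    rw [← ENNReal.ofReal_one]
    congr 1
    ring
  set ω' := ω.tiltFeedback i u hum hup (fun p => Real.toNNReal_pos.2 (hpos p)) hui with hω'
  have hD : ∀ p, φ p.1 * (M.jointDensity θ ω' p : ℝ) =
      φ p.1 * (M.jointDensity θ ω p : ℝ) +
        1 / 4 * (φ p.1 * (M.jointDensity θ ω p : ℝ) * (h p - E p)) := by
    intro p
    rw [hω', jointDensity_tiltFeedback, NNReal.coe_mul, huc]
    ring
  have hs := integrable_mul_of_bdd (h := fun p => h p - E p) hint (hh.sub hEm) hb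
  have h0 := hFHR ω ((integrable_dataLaw_iff hφ).2 hint)
  rw [integral_dataLaw hφ] at h0
  have h0' := hFHR ω' ((integrable_dataLaw_iff hφ).2
    (by simp only [hD]; exact hint.add (hs.const_mul _)))
  rw [integral_dataLaw hφ] at h0'
  simp only [hD] at h0'
  rw [integral_add hint (hs.const_mul _), h0, zero_add, integral_const_mul] at h0'
  exact (mul_eq_zero.1 h0').resolve_left (by norm_num)

/-- Tilting the heterogeneity and the initial condition. -/
theorem IsFHR.integral_initial_eq_zero (hFHR : M.IsFHR θ φ) (hφ : Measurable φ)
    (hint : Integrable (fun p => φ p.1 * (M.jointDensity θ ω p : ℝ)) M.refFull)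
    (hh : Measurable h) (h1 : ∀ p, |h p| ≤ 1) (hpast : DependsOnPast 0 0 h) :
    ∫ p, φ p.1 * (M.jointDensity θ ω p : ℝ) * h p ∂M.refFull = 0 := by
  -- As `h` sees only `(y_0, x_1, a)`, it may be evaluated at constant paths.
  set u : A → Y → X → ℝ≥0 := fun a y x =>
    Real.toNNReal (1 + h ((fun _ => y, fun _ => x), a) / 2) with hu
  have hlow : ∀ p, (1 / 2 : ℝ) ≤ 1 + h p / 2 := fun p => by linarith [(abs_le.1 (h1 p)).1]
  have hupp : ∀ p, 1 + h p / 2 ≤ (3 / 2 : ℝ) := fun p => by linarith [(abs_le.1 (h1 p)).2]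
  have hum : Measurable fun p : A × Y × X => u p.1 p.2.1 p.2.2 := by
    refine Measurable.real_toNNReal (measurable_const.add (Measurable.div_const ?_ 2))
    exact hh.comp (f := fun p : A × Y × X =>
      (((fun _ => p.2.1, fun _ => p.2.2), p.1) : PanelData n Y X × A)) (by fun_prop)
  obtain ⟨ω', Z, hZ, hω'⟩ := ω.exists_tilt_initial u hum (c := Real.toNNReal (1 / 2))
    (C := Real.toNNReal (3 / 2)) (Real.toNNReal_pos.2 (by norm_num))
    (fun a y x => Real.toNNReal_le_toNNReal (hlow _))
    (fun a y x => Real.toNNReal_le_toNNReal (hupp _))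
  have hup : ∀ p : PanelData n Y X × A, (u p.2 (p.1.1 0) (p.1.2 0) : ℝ) = 1 + h p / 2 := by
    intro p
    rw [hu, Real.coe_toNNReal _ (le_trans (by norm_num) (hlow _))]
    congr 2
    refine hpast _ _ (fun j hj => ?_) (fun j hj => ?_) rfl
    · rw [Fin.ext (Nat.le_zero.1 hj) (b := 0)]
    · rw [Fin.ext (Nat.le_zero.1 hj) (b := 0)]
  have hD : ∀ p, φ p.1 * (M.jointDensity θ ω' p : ℝ) =
      (Z : ℝ)⁻¹ * (φ p.1 * (M.jointDensity θ ω p : ℝ) +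
        1 / 2 * (φ p.1 * (M.jointDensity θ ω p : ℝ) * h p)) := by
    intro p
    rw [hω', NNReal.coe_mul, NNReal.coe_mul, hup, NNReal.coe_inv]
    ring
  have hs := integrable_mul_of_bdd hint hh h1
  have h0 := hFHR ω ((integrable_dataLaw_iff hφ).2 hint)
  rw [integral_dataLaw hφ] at h0
  have h0' := hFHR ω' ((integrable_dataLaw_iff hφ).2
    (by simp only [hD]; exact (hint.add (hs.const_mul _)).const_mul _))
  rw [integral_dataLaw hφ] at h0'
  simp only [hD] at h0'
  rw [integral_const_mul, integral_add hint (hs.const_mul _), h0, zero_add,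
    integral_const_mul] at h0'
  have hZ' : (Z : ℝ)⁻¹ ≠ 0 := inv_ne_zero (NNReal.coe_ne_zero.2 hZ.ne')
  exact (mul_eq_zero.1 ((mul_eq_zero.1 h0').resolve_left hZ')).resolve_left (by norm_num)

/-- `χ` is a version of `M.momentFun θ φ k` which depends on the past only, and it is the
conditional mean of `φ` under `ω` given this past. -/
structure IsPastVersion (M : PanelModel n Θ Y X A) (θ : Θ) (φ : PanelData n Y X → ℝ)
    (ω : M.Nuisance) (d : M.ReferenceDensities) (k : Fin (n + 2)) (l : ℕ)
    (χ : PanelData n Y X × A → ℝ) : Prop where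
  measurable : Measurable χ
  past : DependsOnPast k l χ
  ae_eq : ∀ᵐ p ∂M.refFull, M.InSupport θ k p → M.momentFun θ φ k p = χ p
  integrable : Integrable (fun p => χ p * (M.truncDensity θ ω d k l p : ℝ)) M.refFull
  integral_eq : ∀ (h : PanelData n Y X × A → ℝ) (B : ℝ), Measurable h → (∀ p, |h p| ≤ B) →
    DependsOnPast k l h →
      ∫ p, φ p.1 * (M.jointDensity θ ω p : ℝ) * h p ∂M.refFull =
        ∫ p, χ p * h p * (M.truncDensity θ ω d k l p : ℝ) ∂M.refFull

theorem IsPastVersion.integrable_mul {k : Fin (n + 2)} {l : ℕ}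
    (hχ : M.IsPastVersion θ φ ω d k l χ) (hh : Measurable h) {B : ℝ} (hB : ∀ p, |h p| ≤ B) :
    Integrable (fun p => χ p * h p * (M.truncDensity θ ω d k l p : ℝ)) M.refFull :=
  (integrable_mul_of_bdd hχ.integrable hh hB).congr (.of_forall fun p => by ring)

/-- A test function of the smaller past does not see `y_{i+1}` and passes through the outcome mean.
The almost-everywhere identity survives on sections because the outcome density kills the values of
`y_{i+1}` that leave the support. -/
theorem IsPastVersion.outcome {i : Fin (n + 1)} (hχ : M.IsPastVersion θ φ ω d i.succ i χ) :
    M.IsPastVersion θ φ ω d i.castSucc i (M.outcomeMean θ i χ) := by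
  have hY := ω.neZero_μY
  have hint := hχ.integrable
  rw [Fin.val_succ] at hint
  refine ⟨measurable_outcomeMean hχ.measurable i, ?_, ?_, ?_, fun h B hh hB hp => ?_⟩
  · have := hχ.past
    rw [Fin.val_succ] at this
    exact this.outcomeMean
  · filter_upwards [(M.isCoordinate_setY i.succ).ae_section hχ.ae_eq] with p hsec hs
    rw [momentFun_castSucc]
    refine integral_congr_ae ?_
    filter_upwards [hsec] with z hz
    rcases eq_or_ne (M.f θ i z (p.1.1 i.castSucc) (p.1.2 i) p.2) 0 with h0 | h0
    · simp [h0]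
    · rw [hz (inSupport_setY_of_pos i hs (pos_iff_ne_zero.2 h0))]
  · exact (integral_outcomeMean i hχ.measurable hint).1
  · rw [hχ.integral_eq h B hh hB (hp.mono (by simp) le_rfl)]
    have hint' := hχ.integrable_mul hh hB
    rw [Fin.val_succ] at hint' ⊢
    have := (integral_outcomeMean i (F := fun p => χ p * h p) (hχ.measurable.mul hh) hint').2
    rw [outcomeMean_mul i fun p z => hp.setY_eq p z] at this
    exact this.symm

/-- By Fubini almost every section of `χ` times the truncated density is integrable. Along a section
that density is `f` times a constant `C p`, which is nonzero on the support and can be divided out.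
-/
theorem IsPastVersion.integrable_section {i : Fin (n + 1)}
    (hχ : M.IsPastVersion θ φ ω d i.succ i χ) : ∀ᵐ p ∂M.refFull, M.InSupport θ i.castSucc p →
    Integrable (fun z => M.momentFun θ φ i.succ (setY p i.succ z) *
      (M.f θ i z (p.1.1 i.castSucc) (p.1.2 i) p.2 : ℝ)) M.μY := by
  have hY := ω.neZero_μY
  obtain ⟨C, h1, h2⟩ := exists_truncDensity_setY (M := M) (θ := θ) (ω := ω) (d := d) i
  have hint := hχ.integrable
  rw [Fin.val_succ] at hint
  filter_upwards [(M.isCoordinate_setY i.succ).ae_section hχ.ae_eq,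
    (M.isCoordinate_setY i.succ).integrable_section hint] with p hsec hi hs
  have hC : (C p : ℝ) ≠ 0 := by
    have := (truncDensity_pos_iff (ω := ω) (d := d) i.castSucc i p).2 hs
    rw [Fin.val_castSucc, ← setY_self p i.succ, h2] at this
    rw [NNReal.coe_ne_zero]
    intro h
    simp [h] at this
  simp only [h1] at hi
  refine (hi.mul_const (C p : ℝ)⁻¹).congr ?_
  filter_upwards [hsec] with z hz
  rcases eq_or_ne (M.f θ i z (p.1.1 i.castSucc) (p.1.2 i) p.2) 0 with h0 | h0
  · simp [h0]
  · rw [hz (inSupport_setY_of_pos i hs (pos_iff_ne_zero.2 h0)), NNReal.coe_mul]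
    field_simp

/-- The feedback mean is a projection in the sense of conditional means. -/
theorem integral_feedbackMean_self (i : Fin n) (hF : Measurable F)
    (hint : Integrable (fun p => F p * (M.truncDensity θ ω d (i + 1) (i + 1) p : ℝ)) M.refFull) :
    Integrable (fun p => M.feedbackMean ω i F p * (M.truncDensity θ ω d (i + 1) (i + 1) p : ℝ))
        M.refFull ∧
      ∫ p, M.feedbackMean ω i F p * (M.truncDensity θ ω d (i + 1) (i + 1) p : ℝ) ∂M.refFull =
        ∫ p, F p * (M.truncDensity θ ω d (i + 1) (i + 1) p : ℝ) ∂M.refFull := by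
  have := ω.neZero_μX
  obtain ⟨C, h1, -⟩ := exists_truncDensity_setX (M := M) (θ := θ) (ω := ω) (d := d) i
  exact (M.isCoordinate_setX i.succ).refill (measurable_truncDensity _ _)
    (measurable_truncDensity _ _) hF (measurable_feedbackMean hF i) h1 h1
    (fun p => ω.measurable_feedback_update i p) (fun p => ω.lintegral_g i p.1.1 p.1.2 p.2)
    (fun p z => feedbackMean_setX i p z) (fun _ => rfl) hint

/-- The integrand is `|F|` times a density that is positive exactly on the support. -/
theorem ae_eq_zero_of_integral_sign_mul {k : Fin (n + 2)} {l : ℕ} {s : PanelData n Y X × A → ℝ}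
    (hs : ∀ p, F p * s p = |F p|)
    (hint : Integrable (fun p => F p * s p * (M.truncDensity θ ω d k l p : ℝ)) M.refFull)
    (h0 : ∫ p, F p * s p * (M.truncDensity θ ω d k l p : ℝ) ∂M.refFull = 0) :
    ∀ᵐ p ∂M.refFull, M.InSupport θ k p → F p = 0 := by
  rw [integral_eq_zero_iff_of_nonneg (fun p => by
    simp only [hs]; exact mul_nonneg (abs_nonneg _) (NNReal.coe_nonneg _)) hint] at h0
  filter_upwards [h0] with p hp hsupp
  rw [hs] at hp
  have := (truncDensity_pos_iff (ω := ω) (d := d) k l p).2 hsupp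
  exact abs_eq_zero.1 ((mul_eq_zero.1 hp).resolve_right (NNReal.coe_ne_zero.2 this.ne'))

/-- A sign function without zeros. -/
noncomputable def nonzeroSign (t : ℝ) : ℝ := if 0 ≤ t then 1 else -1

theorem measurable_nonzeroSign : Measurable nonzeroSign :=
  Measurable.ite measurableSet_Ici measurable_const measurable_const

theorem abs_nonzeroSign (t : ℝ) : |nonzeroSign t| ≤ 1 := by
  unfold nonzeroSign
  split_ifs <;> simp

theorem mul_nonzeroSign (t : ℝ) : t * nonzeroSign t = |t| := by
  unfold nonzeroSign
  split_ifs with h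
  · rw [mul_one, abs_of_nonneg h]
  · rw [abs_of_neg (not_le.1 h)]; ring

/-- The feedback mean is a self-adjoint projection, and the FHR property makes `χ` orthogonal to
every bounded `s - E s`. Taking `s` to be the sign of `χ - m` gives `∫ |χ - m| D = 0`, so `χ` agrees
on the support with `m`, which no longer involves the covariate. -/
theorem IsPastVersion.feedback {i : Fin n} (hFHR : M.IsFHR θ φ) (hφ : Measurable φ)
    (hφi : Integrable (fun p => φ p.1 * (M.jointDensity θ ω p : ℝ)) M.refFull)
    (hχ : M.IsPastVersion θ φ ω d i.succ.castSucc (i + 1) χ) :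
    M.IsPastVersion θ φ ω d i.succ.castSucc i (M.feedbackMean ω i χ) := by
  have hint := hχ.integrable
  have hpast := hχ.past
  simp only [Fin.val_castSucc, Fin.val_succ] at hint hpast
  set m := M.feedbackMean ω i χ with hm
  have hmm : Measurable m := measurable_feedbackMean hχ.measurable i
  have hmpast : DependsOnPast (i + 1) i m := hpast.feedbackMean
  refine ⟨hmm, hmpast, ?_, (integral_feedbackMean i hχ.measurable hint).1, fun h B hh hB hp => ?_⟩
  · set s : PanelData n Y X × A → ℝ := fun p => nonzeroSign (χ p - m p) with hs
    set E := M.feedbackMean ω i s with hE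
    have hsm : Measurable s := measurable_nonzeroSign.comp (hχ.measurable.sub hmm)
    have hs1 : ∀ p, |s p| ≤ 1 := fun p => abs_nonzeroSign _
    have hspast : DependsOnPast (i + 1) (i + 1) s :=
      hpast.comp₂ (hmpast.mono le_rfl (Nat.le_succ _)) fun a b => nonzeroSign (a - b)
    have hEm : Measurable E := measurable_feedbackMean hsm i
    have hE1 : ∀ p, |E p| ≤ 1 := abs_feedbackMean_le hs1 i
    have hEpast : DependsOnPast (i + 1) i E := hspast.feedbackMean
    have hb : ∀ p, |s p - E p| ≤ 2 := fun p => by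
      have := abs_sub (s p) (E p)
      linarith [hs1 p, hE1 p]
    have hscore := hχ.integral_eq (fun p => s p - E p) 2 (hsm.sub hEm) hb
      (hspast.comp₂ (hEpast.mono le_rfl (Nat.le_succ _)) fun a b => a - b)
    rw [hFHR.integral_feedback_score_eq_zero hφ hφi i hsm hs1 hspast] at hscore
    simp only [Fin.val_castSucc, Fin.val_succ] at hscore
    set D : PanelData n Y X × A → ℝ := fun p => (M.truncDensity θ ω d (i + 1) (i + 1) p : ℝ)
      with hD
    have hmD : Integrable (fun p => m p * D p) M.refFull :=
      (integral_feedbackMean_self i hχ.measurable hint).1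
    have mulInt : ∀ {G k : PanelData n Y X × A → ℝ}, Integrable (fun p => G p * D p) M.refFull →
        Measurable k → (∀ p, |k p| ≤ 1) → Integrable (fun p => G p * k p * D p) M.refFull :=
      fun hG hk hk1 => (integrable_mul_of_bdd hG hk hk1).congr (.of_forall fun p => by ring)
    have iχs := mulInt hint hsm hs1
    have iχE := mulInt hint hEm hE1
    have ims := mulInt hmD hsm hs1
    -- `e1` and `e2` are self-adjointness, obtained by pulling `E` and then `m` out of the mean;
    -- `e3` is orthogonality to the score. Together they give `∫ χ s D = ∫ χ E D = ∫ m E D = ∫ m s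
    -- D`.
    have e1 : ∫ p, m p * E p * D p ∂M.refFull = ∫ p, χ p * E p * D p ∂M.refFull := by
      have := (integral_feedbackMean_self i (F := fun p => χ p * E p)
        (hχ.measurable.mul hEm) iχE).2
      rwa [feedbackMean_mul i fun p z => hEpast.setX_eq p z] at this
    have e2 : ∫ p, m p * E p * D p ∂M.refFull = ∫ p, m p * s p * D p ∂M.refFull := by
      have ims' : Integrable (fun p => s p * m p * D p) M.refFull :=
        ims.congr (.of_forall fun p => by ring)
      have := (integral_feedbackMean_self i (F := fun p => s p * m p) (hsm.mul hmm) ims').2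
      rw [feedbackMean_mul i fun p z => hmpast.setX_eq p z] at this
      simpa only [mul_comm] using this
    have e3 : ∫ p, χ p * s p * D p ∂M.refFull = ∫ p, χ p * E p * D p ∂M.refFull := by
      rw [← sub_eq_zero, ← integral_sub iχs iχE, hscore]
      congr 1
      ext p
      ring
    have e4 : ∫ p, (χ p - m p) * s p * D p ∂M.refFull = 0 := by
      have : ∀ p, (χ p - m p) * s p * D p = χ p * s p * D p - m p * s p * D p := fun p => by ring
      simp only [this]
      rw [integral_sub iχs ims, e3, ← e1, e2, sub_self]
    have i4 : Integrable (fun p => (χ p - m p) * s p * D p) M.refFull :=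
      (iχs.sub ims).congr (.of_forall fun p => by simp only [Pi.sub_apply]; ring)
    filter_upwards [hχ.ae_eq, ae_eq_zero_of_integral_sign_mul (k := i.succ.castSucc)
      (F := fun p => χ p - m p) (s := s) (fun p => mul_nonzeroSign _) i4 e4] with p hp1 hp2 hsupp
    rw [hp1 hsupp]
    exact sub_eq_zero.1 (hp2 hsupp)
  · rw [hχ.integral_eq h B hh hB (hp.mono le_rfl (Nat.le_succ _))]
    have hint' := hχ.integrable_mul hh hB
    simp only [Fin.val_castSucc, Fin.val_succ] at hint' hp ⊢
    have := (integral_feedbackMean i (F := fun p => χ p * h p) (hχ.measurable.mul hh) hint').2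
    rw [feedbackMean_mul i fun p z => hp.setX_eq p z] at this
    exact this.symm

/-- Integrability of `φ` under a single nuisance parameter suffices: the densities are tilted by
bounded factors only, along which the mean of `φ` is an affine function of the tilt, so that no
differentiability of the root likelihood has to be invoked. -/
theorem momentRestrictions_of_isFHR (hFHR : M.IsFHR θ φ) (hφ : Measurable φ) (ω : M.Nuisance)
    (hφω : Integrable φ (M.dataLaw θ ω)) : M.MomentRestrictions θ φ := by
  obtain ⟨d⟩ := ω.nonempty_referenceDensities
  have hφi := (integrable_dataLaw_iff hφ).1 hφω
  have step : ∀ i : Fin (n + 1), (∃ χ, M.IsPastVersion θ φ ω d i.succ (i + 1) χ) →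
      ∃ χ, M.IsPastVersion θ φ ω d i.succ i χ := by
    rintro i ⟨χ, hχ⟩
    induction i using Fin.lastCases with
    | last =>
      rw [Fin.val_last] at hχ ⊢
      -- Covariate indices stop at `n`, so in the last period the levels `n + 1` and `n` coincide
      -- and there is nothing to project.
      have hpast : ∀ {β : Type} {k : ℕ} {F : PanelData n Y X × A → β},
          DependsOnPast k (n + 1) F → DependsOnPast k n F := fun hF p p' hy hx ha =>
        hF p p' hy (fun j _ => hx j (Nat.lt_succ_iff.1 j.2)) ha
      refine ⟨χ, hχ.measurable, hpast hχ.past, hχ.ae_eq, ?_, fun h B hh hB hp => ?_⟩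
      · simpa only [truncDensity_full_succ] using hχ.integrable
      · simpa only [truncDensity_full_succ] using
          hχ.integral_eq h B hh hB (hp.mono le_rfl (Nat.le_succ _))
    | cast j =>
      rw [Fin.succ_castSucc, Fin.val_castSucc] at hχ ⊢
      exact ⟨_, hχ.feedback hFHR hφ hφi⟩
  have main : ∀ k : Fin (n + 2), ∃ χ, M.IsPastVersion θ φ ω d k k χ := by
    intro k
    induction k using Fin.reverseInduction with
    | last =>
      refine ⟨fun p => φ p.1, hφ.comp measurable_fst, fun p p' hy hx _ => ?_, ?_, ?_,
        fun h B _ _ _ => ?_⟩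
      · have h1 : p.1.1 = p'.1.1 := funext fun j => hy j (Nat.lt_succ_iff.1 j.2)
        have h2 : p.1.2 = p'.1.2 := funext fun j => hx j (by rw [Fin.val_last]; omega)
        exact congrArg φ (Prod.ext h1 h2)
      · simp [momentFun_last]
      · simpa only [Fin.val_last, truncDensity_full_succ, truncDensity_full] using hφi
      · simp only [Fin.val_last, truncDensity_full_succ, truncDensity_full]
        congr 1
        ext p
        ring
    | cast i ih =>
      rw [Fin.val_succ] at ih
      obtain ⟨χ, hχ⟩ := step i ih
      exact ⟨_, hχ.outcome⟩
  refine ⟨fun i => ?_, ?_, fun i => ?_⟩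
  · obtain ⟨χ, hχ⟩ := step i (by simpa only [Fin.val_succ] using main i.succ)
    exact hχ.integrable_section
  · obtain ⟨χ, hχ⟩ := main 0
    -- At level 0 the version depends on `(y_0, x_1, a)` alone, so its sign is an admissible tilt of
    -- the initial law.
    have hsm : Measurable fun p => nonzeroSign (χ p) := measurable_nonzeroSign.comp hχ.measurable
    have hs1 : ∀ p, |nonzeroSign (χ p)| ≤ 1 := fun p => abs_nonzeroSign _
    have hsp : DependsOnPast 0 0 fun p => nonzeroSign (χ p) :=
      DependsOnPast.comp₂ hχ.past hχ.past fun a _ => nonzeroSign a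
    have h0 := hχ.integral_eq _ 1 hsm hs1 hsp
    rw [hFHR.integral_initial_eq_zero hφ hφi hsm hs1 hsp] at h0
    filter_upwards [hχ.ae_eq, ae_eq_zero_of_integral_sign_mul (fun p => mul_nonzeroSign _)
      (hχ.integrable_mul hsm hs1) h0.symm] with p hp1 hp2 hsupp
    exact (hp1 hsupp).trans (hp2 hsupp)
  -- The witness `m` is the version after the covariate has been averaged out but before the outcome
  -- is: it sees covariate indices up to `i`, that is, strictly below `i.succ`.
  · obtain ⟨χ, hχ⟩ := step i.castSucc (by simpa only [Fin.val_succ] using main i.castSucc.succ)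
    rw [Fin.succ_castSucc, Fin.val_castSucc] at hχ
    refine ⟨fun y x a => χ ((y, x), a), fun y y' x x' a hy hx => ?_, hχ.ae_eq⟩
    refine hχ.past _ _ (fun j hj => hy j hj) (fun j hj => hx j ?_) rfl
    rw [Fin.lt_def, Fin.val_succ]
    omega

end PanelModel

theorem theorem1 {n : ℕ} {Θ Y X A : Type*}
    [MeasurableSpace Y] [MeasurableSpace X] [MeasurableSpace A]
    (M : PanelModel n Θ Y X A) (θ : Θ)
    (φ : Θ → PanelData n Y X → ℝ) (hφ : Measurable (φ θ)) :
    (M.MomentRestrictions θ (φ θ) → M.IsFHR θ (φ θ)) ∧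
    (∀ (_ : TopologicalSpace M.Nuisance) (ωs : M.Nuisance),
      M.RootLikelihoodDQM θ ωs →
      (∃ N ∈ 𝓝 ωs, (⨆ ω ∈ N, ∫⁻ z, ENNReal.ofReal (|φ θ z| ^ 2) ∂(M.dataLaw θ ω)) < ∞) →
      M.IsFHR θ (φ θ) → M.MomentRestrictions θ (φ θ)) := by
  refine ⟨PanelModel.isFHR_of_momentRestrictions hφ, fun _ ωs _ ⟨N, hN, hsup⟩ hFHR => ?_⟩
  refine PanelModel.momentRestrictions_of_isFHR hFHR hφ ωs ?_
  have := M.isProbabilityMeasure_dataLaw θ ωs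
  -- A neighbourhood contains its centre, so the bound holds at `ωs`; under a probability law square
  -- integrability implies integrability.
  have hlt : ∫⁻ z, ENNReal.ofReal (|φ θ z| ^ 2) ∂(M.dataLaw θ ωs) < ∞ :=
    (le_iSup₂ (f := fun ω (_ : ω ∈ N) =>
      ∫⁻ z, ENNReal.ofReal (|φ θ z| ^ 2) ∂(M.dataLaw θ ω)) ωs (mem_of_mem_nhds hN)).trans_lt hsup
  have hsq : Integrable (fun z => φ θ z ^ 2) (M.dataLaw θ ωs) := by
    refine ⟨(hφ.pow_const 2).aestronglyMeasurable, ?_⟩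
    refine lt_of_le_of_lt (lintegral_mono fun z => ?_) hlt
    rw [Real.enorm_eq_ofReal_abs, abs_pow]
  exact ((memLp_two_iff_integrable_sq hφ.aestronglyMeasurable).2 hsq).integrable one_le_two
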